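/- **Setting.** Let $\mathcal X$ be a set and $\mathcal H\subseteq\{0,1\}^{\mathcal X}$ a hypothesis class. Distributions over $\mathcal X\times\{0,1\}$ are discrete, and $\{0,1\}^{\mathcal X}$ carries the product $\sigma$-algebra. For a hypothesis $h$ let $\mathrm{err}_{\mathcal D}(h)=\Pr_{(x,y)\sim\mathcal D}[h(x)\ne y]$; $\mathcal D$ is labelled by $h$ if $y=h(x)$ almost surely. A probability distribution $\mathcal P$ over (listed) finite hypothesis classes $V$ is an $(\alpha,\beta)$-probabilistic representation for $\mathcal H$ if for every $h^\star\in\mathcal H$ and every $\mathcal D$ labelled by $h^\star$, $\Pr_{V\sim\mathcal P}[\exists v\in V:\ \mathrm{err}_{\mathcal D}(v)\le\alpha]\ge 1-\beta$. Let $\mathrm{size}(\mathcal P)$ be the (essential) maximum of $\ln|V|$ over $V\sim\mathcal P$, and let $\mathrm{RepDim}(\mathcal H)\in[0,\infty]$ be the minimum of $\mathrm{size}(\mathcal P)$ over all $(1/4,1/4)$-probabilistic representations $\mathcal P$ for $\mathcal H$. A randomized algorithm $\mathcal A$ is $\varepsilon$-DP if $\Pr[\mathcal A(S_1)\in O]\le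 e^{\varepsilon}\Pr[\mathcal A(S_2)\in O]$ for all datasets $S_1,S_2$ of the same length that differ in only one entry and all measurable events $O$. An online learner for $T$ rounds outputs in each round $t$ a hypothesis $h_t\in\{0,1\}^{\mathcal X}$ that depends on its internal randomness and on $(x_1,y_1),\dots,(x_{t-1},y_{t-1})$; as an algorithm it maps $S=((x_t,y_t))_{t\le T}$ to $(h_1,\dots,h_T)$, and its expected number of mistakes on $S$ is $\mathbb E\big[\sum_{t=1}^T\mathbf 1[h_t(x_t)\ne y_t]\big]$. The adversary is oblivious: $S$ is fixed in advance (possibly knowing the learner, but not its randomness). $S$ is realizable if some $h^\star\in\mathcal H$ has $y_t=h^\star(x_t)$ for all $t$. **Theorem.** (1) There is a universal constant $C>0$ such that for every $\mathcal X$ and $\mathcal H$ with $\mathrm{RepDim}(\mathcal H)<\infty$, every $T\ge 3$ and every $\varepsilon>0$ there is an $\varepsilon$-DP online learner whose expected number of mistakes on every realizable sequence $S$ of length $T$ is at most $$C\cdot\frac{\log^2T\,\big(\mathrm{RepDim}(\mathcal H)+\log\log T\big)^2}{\min\{\varepsilon,1\}},$$ that is, $O\big(\log^2T\,(\mathrm{RepDim}(\mathcal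 H)+\log\log T)^2/\varepsilon\big)$ for $\varepsilon\le 1$. (2) Consequently, pure private PAC learnability implies pure private online learnability against oblivious adversaries. Precisely, suppose that for some $\varepsilon_0>0$ and for all $\alpha,\beta\in(0,1)$ there are $n$ and an $\varepsilon_0$-DP algorithm $\mathcal A:(\mathcal X\times\{0,1\})^n\to\{0,1\}^{\mathcal X}$ such that $\Pr_{S\sim\mathcal D^n,\,\mathcal A}[\mathrm{err}_{\mathcal D}(\mathcal A(S))\le\alpha]\ge 1-\beta$ for every $h^\star\in\mathcal H$ and every $\mathcal D$ labelled by $h^\star$. Then for every $\varepsilon>0$ there are a function $M$ with $M(T)=o(T)$ and, for every $T$, an $\varepsilon$-DP online learner whose expected number of mistakes on every realizable sequence of length $T$ is at most $M(T)$. -/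

import Mathlib

open MeasureTheory
open scoped ENNReal

universe u

namespace PrivateOnline

/-- Two datasets of length `n` that differ in (at most) one entry. -/
def Neighbors {Z : Type*} {n : ℕ} (S₁ S₂ : Fin n → Z) : Prop :=
  ∃ i, ∀ j, j ≠ i → S₁ j = S₂ j

/-- A randomized algorithm, given by the law `A S` of its output on each dataset `S`, is
`ε`-differentially private (pure differential privacy). -/
def IsPureDP {Z : Type*} {R : Type*} [MeasurableSpace R] {n : ℕ} (ε : ℝ)
    (A : (Fin n → Z) → Measure R) : Prop :=
  ∀ S₁ S₂, Neighbors S₁ S₂ → ∀ O : Set R, MeasurableSet O →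
    A S₁ O ≤ ENNReal.ofReal (Real.exp ε) * A S₂ O

/-! ### Labelled distributions and representation dimension

Hypotheses are functions `X → Bool`, with the product σ-algebra (generated by the evaluations at
points of `X`). A distribution over examples is a `PMF` on `X × Bool`, so that `X` is a bare set and
the error of every hypothesis is defined. -/

/-- The error `Pr_{(x, y) ∼ D} [h x ≠ y]`. -/
noncomputable def err {X : Type u} (D : PMF (X × Bool)) (h : X → Bool) : ℝ≥0∞ :=
  D.toOuterMeasure {z | h z.1 ≠ z.2}

/-- The distribution `D` over examples is labelled by `h`. -/
def LabelledBy {X : Type u} (D : PMF (X × Bool)) (h : X → Bool) : Prop :=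
  ∀ z ∈ D.support, z.2 = h z.1

/-- A finite hypothesis class `V = {V.2 0, …, V.2 (k - 1)}`, listed, of size `k = V.1`.
The σ-algebra is the one of a disjoint union of finite powers of `X → Bool`. -/
abbrev FiniteClass (X : Type u) : Type u := Σ k : ℕ, (Fin k → X → Bool)

/-- The probability distribution `P` over finite hypothesis classes is an `(α, β)`-probabilistic
representation for `H`. -/
def IsProbRep {X : Type u} (H : Set (X → Bool)) (α β : ℝ≥0∞)
    (P : Measure (FiniteClass X)) : Prop :=
  IsProbabilityMeasure P ∧
    ∀ h ∈ H, ∀ D : PMF (X × Bool), LabelledBy D h →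
      1 - β ≤ P {V | ∃ i, err D (V.2 i) ≤ α}

/-- `size P`, the (essential) maximum of `ln |V|` over `V ∼ P`. -/
noncomputable def size {X : Type u} (P : Measure (FiniteClass X)) : ℝ≥0∞ :=
  essSup (fun V => ENNReal.ofReal (Real.log V.1)) P

/-- The representation dimension of `H`; it is `⊤` if no representation has finite size. -/
noncomputable def repDim {X : Type u} (H : Set (X → Bool)) : ℝ≥0∞ :=
  ⨅ (P : Measure (FiniteClass X)) (_ : IsProbRep H (1 / 4) (1 / 4) P), size P

/-! ### Online learning -/

/-- A randomized online learning algorithm for `T` rounds: internal randomness `ω ∼ μ`, and in each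
round `t` a hypothesis that depends on `ω` and on the examples revealed in the rounds before `t`. -/
structure OnlineLearner (X : Type u) (T : ℕ) where
  Ω : Type u
  [mΩ : MeasurableSpace Ω]
  μ : Measure Ω
  [prob : IsProbabilityMeasure μ]
  predict : (t : Fin T) → (Fin t → X × Bool) → Ω → X → Bool
  measurable_predict : ∀ t past, Measurable (predict t past)

attribute [instance] OnlineLearner.mΩ OnlineLearner.prob

/-- The hypotheses `h_1, …, h_T` output on the stream `S` under the randomness `ω`. -/
def OnlineLearner.outputs {X : Type u} {T : ℕ} (A : OnlineLearner X T) (S : Fin T → X × Bool)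
    (ω : A.Ω) : Fin T → X → Bool :=
  fun t => A.predict t (fun s => S (Fin.castLE t.isLt.le s)) ω

theorem OnlineLearner.measurable_outputs {X : Type u} {T : ℕ} (A : OnlineLearner X T)
    (S : Fin T → X × Bool) : Measurable (A.outputs S) :=
  measurable_pi_lambda _ fun t => A.measurable_predict t _

/-- The joint law of all outputs on the stream `S`, chosen in advance (oblivious adversary). -/
noncomputable def OnlineLearner.law {X : Type u} {T : ℕ} (A : OnlineLearner X T)
    (S : Fin T → X × Bool) : Measure (Fin T → X → Bool) :=
  A.μ.map (A.outputs S)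

instance OnlineLearner.isProbabilityMeasure_law {X : Type u} {T : ℕ} (A : OnlineLearner X T)
    (S : Fin T → X × Bool) : IsProbabilityMeasure (A.law S) :=
  Measure.isProbabilityMeasure_map (A.measurable_outputs S).aemeasurable

/-- The expected number of mistakes on the stream `S`. -/
noncomputable def OnlineLearner.expectedMistakes {X : Type u} {T : ℕ} (A : OnlineLearner X T)
    (S : Fin T → X × Bool) : ℝ≥0∞ :=
  ∫⁻ ω, ∑ t, (if A.outputs S ω t (S t).1 ≠ (S t).2 then 1 else 0) ∂A.μ

/-- The stream `S` is realizable by the class `H`. -/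
def Realizable {X : Type u} {T : ℕ} (H : Set (X → Bool)) (S : Fin T → X × Bool) : Prop :=
  ∃ h ∈ H, ∀ t, (S t).2 = h (S t).1

/-- `H` is online learnable under `ε`-differential privacy against oblivious adversaries in the
realizable setting: for every horizon there is an `ε`-DP learner, with `o(T)` expected mistakes. -/
def OnlineLearnableDP {X : Type u} (ε : ℝ) (H : Set (X → Bool)) : Prop :=
  ∃ (A : (T : ℕ) → OnlineLearner X T) (M : ℕ → ℝ),
    M =o[Filter.atTop] (fun T : ℕ => (T : ℝ)) ∧
      ∀ T, IsPureDP ε (A T).law ∧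
        ∀ S : Fin T → X × Bool, Realizable H S →
          (A T).expectedMistakes S ≤ ENNReal.ofReal (M T)

/-! ### PAC learning -/

/-- `A` is an `(α, β)`-PAC learner for `H` with `n` samples: if `D` is labelled by a member of `H`,
then with probability at least `1 - β` over `S ∼ D ^ n` and `h ∼ A S`, the error of `h` is at
most `α`. -/
def IsPACLearner {X : Type u} {n : ℕ} (H : Set (X → Bool)) (α β : ℝ≥0∞)
    (A : (Fin n → X × Bool) → Measure (X → Bool)) : Prop :=
  ∀ h ∈ H, ∀ D : PMF (X × Bool), LabelledBy D h →
    1 - β ≤ ∑' S : Fin n → X × Bool, (∏ i, D (S i)) * A S {g | err D g ≤ α}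

/-- `H` is PAC learnable (with a possibly improper learner) under `ε`-differential privacy: for all
accuracy and confidence parameters some finite number of samples suffices. -/
def PACLearnableDP {X : Type u} (ε : ℝ) (H : Set (X → Bool)) : Prop :=
  ∀ α β : ℝ≥0∞, 0 < α → α < 1 → 0 < β → β < 1 →
    ∃ (n : ℕ) (A : (Fin n → X × Bool) → Measure (X → Bool)),
      (∀ S, IsProbabilityMeasure (A S)) ∧ IsPureDP ε A ∧ IsPACLearner H α β A

end PrivateOnline

/-! Part (1) combines a data-independent reduction to finitely many experts with a private learner
for them.

Reduction. A representation of size slightly above RepDim yields a random list of `N` hypotheses,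
`log N` about RepDim, that for each fixed weighting of a realizable stream contains a hypothesis of
weighted error at most 1/4, with probability at least 3/4. Boost through `r` of order `log T`
independent stages, each stage the union of `r` independent lists. Since the adversary is oblivious,
the weights at a stage depend only on earlier stages, so every stage succeeds except with small
probability. The class of all majority votes with one hypothesis per stage then contains a
consistent one except with probability at most `1 / T` (`measure_majorityVotes_le`). It has `(r * N)
^ r` members, whose logarithm is of order `log T * (RepDim + log log T)` (`log_experts_le`). It is
drawn without looking at the data, so it costs no privacy.

Experts. The learner follows one expert for a random time, then redraws by the exponential
mechanism, with boundedly many switches. The probability of not having left an expert is `1 / (1 +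
odds)`, where each round adds `scale * base ^ (mistakes so far)` to the odds. One changed round
alters mistake counts by at most one, and alters the leaving time of only the phase containing it,
so all leaving times together cost `base ^ 4` whatever the horizon; each redraw costs `exp (2 *
rate)` (`historyProb_le`). For utility, a phase has few expected mistakes because the odds explode
after `M` of them (`sum_mistakes_div_le`), and leaving before `m` mistakes is unlikely. After a
leave at `m` mistakes or more the total weight has shrunk on average by a constant factor: of two
experts drawn from the same weights, one reaches `m` mistakes no later than the other
(`sum_race_le`). A consistent expert keeps the total weight at least 1, so `O(L)` switches suffice,
where `L` is the logarithm of the number of experts plus `log T`. Each phase costs `O(L / ε)`, which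
gives `O(L ^ 2 / ε)` (`tunedParams_value`).

Part (2). By group privacy the output law on one fixed dataset already hits a good hypothesis with
probability bounded below for every target; independent copies form a representation
(`repDim_lt_top`), and the bound of (1) is `o(T)`. -/

namespace PrivateOnline

/-! ### Sampling from causal laws -/

section Sampling

variable {α : Type}

/-- Independent samples from every law on `α`, for every point in time. -/
noncomputable def sampler (α : Type) [MeasurableSpace α] : Measure (ℕ × PMF α → α) :=
  Measure.infinitePi fun j => j.2.toMeasure

instance [MeasurableSpace α] : IsProbabilityMeasure (sampler α) := by
  unfold sampler; infer_instance

/-- The random history after `t` steps (latest symbol first), if the next symbol after the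
history `l` has law `P l`. -/
def run (P : List α → PMF α) (ω : ℕ × PMF α → α) : ℕ → List α
  | 0 => []
  | t + 1 => ω (t, P (run P ω t)) :: run P ω t

/-- The probability of a history. -/
noncomputable def pathProb (P : List α → PMF α) : List α → ℝ≥0∞
  | [] => 1
  | a :: l => pathProb P l * P l a

theorem length_run (P : List α → PMF α) (ω : ℕ × PMF α → α) (t : ℕ) :
    (run P ω t).length = t := by
  induction t with
  | zero => rfl
  | succ t ih => simp [run, ih]

theorem run_congr {P Q : List α → PMF α} (ω : ℕ × PMF α → α) {t : ℕ}
    (h : ∀ l : List α, l.length < t → P l = Q l) : run P ω t = run Q ω t := by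
  induction t with
  | zero => rfl
  | succ t ih =>
    have := ih fun l hl => h l (hl.trans (Nat.lt_succ_self t))
    rw [run, run, this, h _ (by rw [length_run]; exact Nat.lt_succ_self t)]

/-- A run consults one coordinate per time. The time stamps make these coordinates distinct, even
when the same law recurs, so a prescribed history is a cylinder and independence multiplies its
probabilities. Indexing the samples by laws keeps the randomness itself independent of the data. -/
theorem exists_cylinder (P : List α → PMF α) (l : List α) :
    ∃ (s : Finset (ℕ × PMF α)) (v : ℕ × PMF α → α), (∀ j ∈ s, j.1 < l.length) ∧
      {ω | run P ω l.length = l} = Set.pi s (fun j => {v j}) ∧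
      ∏ j ∈ s, j.2 (v j) = pathProb P l := by
  classical
  induction l with
  | nil =>
    obtain ⟨a, _⟩ := (P []).support_nonempty
    exact ⟨∅, fun _ => a, by simp, by simp [run], by simp [pathProb]⟩
  | cons a l ih =>
    obtain ⟨s, v, hs, hset, hprod⟩ := ih
    have hnot : (l.length, P l) ∉ s := fun h => (hs _ h).false
    have hv : ∀ j ∈ s, Function.update v (l.length, P l) a j = v j := fun j hj =>
      Function.update_of_ne (by rintro rfl; exact hnot hj) _ _
    refine ⟨insert (l.length, P l) s, Function.update v (l.length, P l) a, ?_, ?_, ?_⟩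
    · intro j hj
      rcases Finset.mem_insert.1 hj with rfl | hj
      · simp
      · exact (hs j hj).trans (by simp)
    · ext ω
      have h1 : run P ω l.length = l ↔ ∀ j ∈ s, ω j = v j := by
        have := Set.ext_iff.1 hset ω
        simpa [Set.mem_pi] using this
      simp only [List.length_cons, run, Set.mem_ofPred_eq, List.cons.injEq, Finset.coe_insert,
        Set.mem_pi, Set.mem_insert_iff, Finset.mem_coe, Set.mem_singleton_iff]
      constructor
      · rintro ⟨h2, h3⟩ j (rfl | hj)
        · rw [h3] at h2; simpa using h2
        · rw [hv j hj]; exact h1.1 h3 j hj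
      · intro h
        have h3 : run P ω l.length = l := h1.2 fun j hj => by
          rw [← hv j hj]; exact h j (Or.inr hj)
        refine ⟨?_, h3⟩
        rw [h3]; simpa using h _ (Or.inl rfl)
    · rw [Finset.prod_insert hnot, pathProb, ← hprod, mul_comm]
      congr 1
      · exact Finset.prod_congr rfl fun j hj => by rw [hv j hj]
      · simp

variable [MeasurableSpace α] [MeasurableSingletonClass α]

theorem measurableSet_run_eq (P : List α → PMF α) (t : ℕ) (l : List α) :
    MeasurableSet {ω | run P ω t = l} := by
  by_cases h : l.length = t
  · subst h
    obtain ⟨s, v, -, hset, -⟩ := exists_cylinder P l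
    rw [hset]
    exact MeasurableSet.pi s.countable_toSet fun j _ => measurableSet_singleton _
  · have : {ω | run P ω t = l} = ∅ := by
      ext ω
      simp only [Set.mem_ofPred_eq, Set.mem_empty_iff_false, iff_false]
      rintro rfl
      exact h (length_run P ω t)
    rw [this]; exact MeasurableSet.empty

theorem sampler_run_eq (P : List α → PMF α) (l : List α) :
    sampler α {ω | run P ω l.length = l} = pathProb P l := by
  obtain ⟨s, v, -, hset, hprod⟩ := exists_cylinder P l
  rw [hset, sampler, Measure.infinitePi_pi _ (fun j _ => measurableSet_singleton _), ← hprod]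
  exact Finset.prod_congr rfl fun j _ => PMF.toMeasure_apply_singleton _ _ (measurableSet_singleton _)

theorem measurable_run_comp [Countable α] {β : Type*} [MeasurableSpace β] (P : List α → PMF α) (t : ℕ)
    (f : List α → β) : Measurable fun ω => f (run P ω t) := by
  let _ : MeasurableSpace (List α) := ⊤
  have h1 : Measurable fun ω => run P ω t := measurable_to_countable' fun l =>
    measurableSet_run_eq P t l
  exact (measurable_from_top (f := f)).comp h1

theorem lintegral_run [Countable α] (P : List α → PMF α) (t : ℕ) (f : List α → ℝ≥0∞) :
    ∫⁻ ω, f (run P ω t) ∂sampler α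
      = ∑' l : List α, f l * sampler α {ω | run P ω t = l} := by
  let _ : MeasurableSpace (List α) := ⊤
  have h1 : Measurable fun ω => run P ω t := measurable_to_countable' fun l =>
    measurableSet_run_eq P t l
  have h2 : Measurable f := measurable_from_top
  rw [← lintegral_map h2 h1, lintegral_countable']
  refine tsum_congr fun l => ?_
  rw [Measure.map_apply h1 (measurableSet_singleton l)]
  rfl

theorem lintegral_run_succ [Fintype α] (P : List α → PMF α) (t : ℕ) (f : List α → ℝ≥0∞) :
    ∫⁻ ω, f (run P ω (t + 1)) ∂sampler α
      = ∫⁻ ω, ∑ a, P (run P ω t) a * f (a :: run P ω t) ∂sampler α := by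
  rw [lintegral_run P t fun l => ∑ a, P l a * f (a :: l), lintegral_run P (t + 1)]
  have key : ∀ l : List α, ∀ a, sampler α {ω | run P ω (t + 1) = a :: l}
      = P l a * sampler α {ω | run P ω t = l} := by
    intro l a
    by_cases h : l.length = t
    · subst h
      rw [sampler_run_eq, show l.length + 1 = (a :: l).length from rfl, sampler_run_eq, pathProb,
        mul_comm]
    · have h1 : {ω | run P ω (t + 1) = a :: l} = ∅ := by
        ext ω
        simp only [Set.mem_ofPred_eq, Set.mem_empty_iff_false, iff_false]
        intro h'
        have := congrArg List.length h'
        rw [length_run] at this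
        exact h (by simpa using this.symm)
      have h2 : {ω | run P ω t = l} = ∅ := by
        ext ω
        simp only [Set.mem_ofPred_eq, Set.mem_empty_iff_false, iff_false]
        rintro rfl
        exact h (length_run P ω t)
      rw [h1, h2]; simp
  have hinj : Function.Injective fun p : α × List α => p.1 :: p.2 := by
    rintro ⟨a, l⟩ ⟨b, m⟩ h
    simpa using h
  have hsupp : Function.support
      (fun l : List α => f l * sampler α {ω | run P ω (t + 1) = l})
      ⊆ Set.range fun p : α × List α => p.1 :: p.2 := by
    intro l hl
    cases l with
    | nil =>
      exfalso
      apply hl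
      have : {ω : ℕ × PMF α → α | run P ω (t + 1) = []} = ∅ := by
        ext ω; simp [run]
      simp [this]
    | cons a l => exact ⟨(a, l), rfl⟩
  rw [← hinj.tsum_eq hsupp, ENNReal.tsum_prod (f := fun a l => f (a :: l) *
    sampler α {ω | run P ω (t + 1) = a :: l}), ENNReal.tsum_comm]
  refine tsum_congr fun l => ?_
  rw [tsum_fintype, Finset.sum_mul]
  refine Finset.sum_congr rfl fun a _ => ?_
  rw [key]; ring

/-- A supersolution of the backward recursion bounds the expected total cost. -/
theorem lintegral_cost_le [Fintype α] (P : List α → PMF α) (T : ℕ) (c G : List α → ℝ≥0∞)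
    (h : ∀ l : List α, l.length < T → c l + ∑ a, P l a * G (a :: l) ≤ G l) :
    ∫⁻ ω, ∑ t ∈ Finset.range T, c (run P ω t) ∂sampler α ≤ G [] := by
  have key : ∀ t ≤ T, ∫⁻ ω, ∑ t ∈ Finset.range t, c (run P ω t) ∂sampler α
      + ∫⁻ ω, G (run P ω t) ∂sampler α ≤ G [] := by
    intro t ht
    induction t with
    | zero => simp [run]
    | succ t ih =>
      refine le_trans ?_ (ih (by lia))
      simp_rw [Finset.sum_range_succ]
      rw [lintegral_add_right _ (measurable_run_comp P t c), lintegral_run_succ, add_assoc,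
        ← lintegral_add_left (measurable_run_comp P t c)]
      gcongr with ω
      exact h _ (by rw [length_run]; lia)
  exact le_trans le_self_add (key T le_rfl)

/-- If history probabilities compare pointwise then so do probabilities of events. -/
theorem sampler_run_mem_le [Countable α] (P Q : List α → PMF α) (T : ℕ) (C : ℝ≥0∞)
    (h : ∀ l : List α, l.length = T → pathProb P l ≤ C * pathProb Q l) (B : Set (List α)) :
    sampler α {ω | run P ω T ∈ B} ≤ C * sampler α {ω | run Q ω T ∈ B} := by
  classical
  have conv : ∀ R : List α → PMF α, sampler α {ω | run R ω T ∈ B}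
      = ∑' l : List α, B.indicator 1 l * sampler α {ω | run R ω T = l} := by
    intro R
    rw [← lintegral_run R T (B.indicator 1), ← lintegral_indicator_one]
    · rfl
    · exact measurableSet_setOfPred.2 (measurable_run_comp R T (· ∈ B))
  rw [conv, conv, ← ENNReal.tsum_mul_left]
  refine ENNReal.tsum_le_tsum fun l => ?_
  rw [mul_left_comm]
  gcongr
  by_cases hl : l.length = T
  · subst hl
    rw [sampler_run_eq, sampler_run_eq]
    exact h l rfl
  · have : {ω | run P ω T = l} = ∅ := by
      ext ω
      simp only [Set.mem_ofPred_eq, Set.mem_empty_iff_false, iff_false]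
      rintro rfl
      exact hl (length_run P ω T)
    simp [this]

end Sampling
/-! ### A lazy exponential-mechanism learner for finitely many experts -/

section Experts

/-- Parameters of the learner: the first expert, the maximal number of switches, the learning rate
of the exponential mechanism, and the growth rate and scale of the switching hazard. -/
structure ExpertParams (I : Type) where
  first : I
  switches : ℕ
  rate : ℝ
  base : ℝ
  scale : ℝ
  rate_nonneg : 0 ≤ rate
  one_le_base : 1 ≤ base
  scale_pos : 0 < scale

variable {I : Type}

/-- Number of mistakes of expert `i` in the rounds `a ≤ r < t`. -/
def cnt (ℓ : ℕ → I → Bool) (i : I) (a t : ℕ) : ℕ := ∑ r ∈ Finset.Ico a t, (ℓ r i).toNat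

/-- Increase, in round `r`, of the odds of having left expert `i`, followed since round `a`. -/
noncomputable def inc (p : ExpertParams I) (ℓ : ℕ → I → Bool) (i : I) (a r : ℕ) : ℝ :=
  p.scale * p.base ^ cnt ℓ i a (r + 1)

/-- The odds, before round `t`, of having left expert `i`, followed since round `a`, if `k` switches
are left. -/
noncomputable def odds (p : ExpertParams I) (ℓ : ℕ → I → Bool) (k : ℕ) (i : I) (a t : ℕ) : ℝ :=
  if k = 0 then 0 else ∑ r ∈ Finset.Ico a t, inc p ℓ i a r

/-- Weight of expert `i` before round `t`. -/
noncomputable def wt (p : ExpertParams I) (ℓ : ℕ → I → Bool) (t : ℕ) (i : I) : ℝ :=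
  Real.exp (-(p.rate * cnt ℓ i 0 t))

/-- Total weight of all experts before round `t`. -/
noncomputable def totalWt [Fintype I] (p : ExpertParams I) (ℓ : ℕ → I → Bool) (t : ℕ) : ℝ :=
  ∑ i, wt p ℓ t i

/-- Probability to keep, after round `t`, the expert `i` followed since round `a`. -/
noncomputable def keepProb (p : ExpertParams I) (ℓ : ℕ → I → Bool) (k : ℕ) (i : I) (a t : ℕ) : ℝ :=
  (1 + odds p ℓ k i a t) / (1 + odds p ℓ k i a (t + 1))

/-- The current expert, the round since which it has been followed, and the number of switches that
are left, after a history of decisions (`none` for keeping the expert). -/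
def expertState (p : ExpertParams I) : List (Option I) → I × ℕ × ℕ
  | [] => (p.first, 0, p.switches)
  | none :: l => expertState p l
  | some j :: l => (j, l.length + 1, (expertState p l).2.2 - 1)

/-- The expert followed after a history. -/
def curExpert (p : ExpertParams I) (l : List (Option I)) : I := (expertState p l).1

/-- The round since which the current expert has been followed. -/
def phaseStart (p : ExpertParams I) (l : List (Option I)) : ℕ := (expertState p l).2.1

/-- The number of switches left. -/
def switchesLeft (p : ExpertParams I) (l : List (Option I)) : ℕ := (expertState p l).2.2

theorem phaseStart_le (p : ExpertParams I) (l : List (Option I)) : phaseStart p l ≤ l.length := by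
  induction l with
  | nil => simp [phaseStart, expertState]
  | cons a l ih =>
    cases a with
    | none => exact ih.trans (by simp)
    | some j => simp [phaseStart, expertState]

theorem inc_pos (p : ExpertParams I) (ℓ : ℕ → I → Bool) (i : I) (a r : ℕ) : 0 < inc p ℓ i a r :=
  mul_pos p.scale_pos (pow_pos (zero_lt_one.trans_le p.one_le_base) _)

theorem odds_nonneg (p : ExpertParams I) (ℓ : ℕ → I → Bool) (k : ℕ) (i : I) (a t : ℕ) :
    0 ≤ odds p ℓ k i a t := by
  unfold odds
  split_ifs
  · exact le_rfl
  · exact Finset.sum_nonneg fun r _ => (inc_pos p ℓ i a r).le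

theorem odds_pos (p : ExpertParams I) (ℓ : ℕ → I → Bool) (k : ℕ) (i : I) (a t : ℕ) :
    0 < 1 + odds p ℓ k i a t := by linarith [odds_nonneg p ℓ k i a t]

theorem odds_zero (p : ExpertParams I) (ℓ : ℕ → I → Bool) (i : I) (a t : ℕ) :
    odds p ℓ 0 i a t = 0 := by simp [odds]

theorem odds_self (p : ExpertParams I) (ℓ : ℕ → I → Bool) (k : ℕ) (i : I) (a : ℕ) :
    odds p ℓ k i a a = 0 := by simp [odds]

theorem odds_succ (p : ExpertParams I) (ℓ : ℕ → I → Bool) {k : ℕ} (hk : k ≠ 0) (i : I) {a t : ℕ}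
    (h : a ≤ t) : odds p ℓ k i a (t + 1) = odds p ℓ k i a t + inc p ℓ i a t := by
  simp [odds, hk, Finset.sum_Ico_succ_top h]

theorem odds_mono (p : ExpertParams I) (ℓ : ℕ → I → Bool) (k : ℕ) (i : I) (a : ℕ) :
    Monotone (odds p ℓ k i a) := by
  intro s t h
  unfold odds
  split_ifs
  · exact le_rfl
  · exact Finset.sum_le_sum_of_subset_of_nonneg (Finset.Ico_subset_Ico_right h)
      fun r _ _ => (inc_pos p ℓ i a r).le

theorem keepProb_pos (p : ExpertParams I) (ℓ : ℕ → I → Bool) (k : ℕ) (i : I) (a t : ℕ) :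
    0 < keepProb p ℓ k i a t := div_pos (odds_pos ..) (odds_pos ..)

theorem keepProb_le_one (p : ExpertParams I) (ℓ : ℕ → I → Bool) (k : ℕ) (i : I) (a t : ℕ) :
    keepProb p ℓ k i a t ≤ 1 := by
  rw [keepProb, div_le_one (odds_pos ..)]
  linarith [odds_mono p ℓ k i a (Nat.le_succ t)]

theorem wt_pos (p : ExpertParams I) (ℓ : ℕ → I → Bool) (t : ℕ) (i : I) : 0 < wt p ℓ t i :=
  Real.exp_pos _

theorem cnt_mono (ℓ : ℕ → I → Bool) (i : I) (a : ℕ) : Monotone (cnt ℓ i a) := fun _ _ h =>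
  Finset.sum_le_sum_of_subset (Finset.Ico_subset_Ico_right h)

theorem cnt_add (ℓ : ℕ → I → Bool) (i : I) {a b t : ℕ} (h : a ≤ b) (h' : b ≤ t) :
    cnt ℓ i a b + cnt ℓ i b t = cnt ℓ i a t :=
  Finset.sum_Ico_consecutive _ h h'

/-- Expected mistakes in the rounds `t, …, T - 1` if before round `t` expert `i`, followed since
round `a`, is still followed, and switching before round `r` incurs `F r` mistakes. -/
noncomputable def phaseValue (p : ExpertParams I) (ℓ : ℕ → I → Bool) (T k : ℕ) (F : ℕ → ℝ) (i : I)
    (a t : ℕ) : ℝ :=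
  (1 + odds p ℓ k i a t) * ∑ r ∈ Finset.Ico t T,
    ((ℓ r i).toNat / (1 + odds p ℓ k i a r) +
      ((1 + odds p ℓ k i a r)⁻¹ - (1 + odds p ℓ k i a (r + 1))⁻¹) * F (r + 1))

theorem hazard_nonneg (p : ExpertParams I) (ℓ : ℕ → I → Bool) (k : ℕ) (i : I) (a r : ℕ) :
    0 ≤ (1 + odds p ℓ k i a r)⁻¹ - (1 + odds p ℓ k i a (r + 1))⁻¹ :=
  sub_nonneg.2 (inv_anti₀ (odds_pos ..) (by linarith [odds_mono p ℓ k i a (Nat.le_succ r)]))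

theorem phaseValue_nonneg (p : ExpertParams I) (ℓ : ℕ → I → Bool) (T k : ℕ) {F : ℕ → ℝ}
    (hF : ∀ t, 0 ≤ F t) (i : I) (a t : ℕ) : 0 ≤ phaseValue p ℓ T k F i a t :=
  mul_nonneg (odds_pos ..).le (Finset.sum_nonneg fun _ _ => add_nonneg
    (div_nonneg (Nat.cast_nonneg _) (odds_pos ..).le) (mul_nonneg (hazard_nonneg ..) (hF _)))

theorem toNat_le_one_real (b : Bool) : (b.toNat : ℝ) ≤ 1 := by
  cases b <;> simp

/-- With at most one mistake per round, the summand is at most the increment of `-(T - r)` times the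
survival probability, and the sum telescopes. -/
theorem phaseValue_le_horizon (p : ExpertParams I) (ℓ : ℕ → I → Bool) (T k : ℕ) {F : ℕ → ℝ}
    (hF : ∀ t ≤ T, F t ≤ T - t) (i : I) (a : ℕ) {t : ℕ} (ht : t ≤ T) :
    phaseValue p ℓ T k F i a t ≤ T - t := by
  set S : ℕ → ℝ := fun r => (1 + odds p ℓ k i a r)⁻¹ with hS
  have hsum : ∑ r ∈ Finset.Ico t T, ((ℓ r i).toNat / (1 + odds p ℓ k i a r) +
      ((1 + odds p ℓ k i a r)⁻¹ - (1 + odds p ℓ k i a (r + 1))⁻¹) * F (r + 1))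
      ≤ ∑ r ∈ Finset.Ico t T, ((fun r : ℕ => -((T : ℝ) - r) * S r) (r + 1)
        - (fun r : ℕ => -((T : ℝ) - r) * S r) r) := by
    refine Finset.sum_le_sum fun r hr => ?_
    have hr' : r + 1 ≤ T := (Finset.mem_Ico.1 hr).2
    have h1 : ((ℓ r i).toNat : ℝ) / (1 + odds p ℓ k i a r) ≤ S r := by
      rw [div_eq_mul_inv]
      exact mul_le_of_le_one_left (inv_nonneg.2 (odds_pos ..).le) (toNat_le_one_real _)
    have h2 := mul_le_mul_of_nonneg_left (hF _ hr') (hazard_nonneg p ℓ k i a r)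
    refine (add_le_add h1 h2).trans (le_of_eq ?_)
    simp only [hS]
    push_cast
    ring
  rw [Finset.sum_Ico_sub (fun r : ℕ => -((T : ℝ) - r) * S r) ht] at hsum
  have hpos := odds_pos p ℓ k i a t
  calc phaseValue p ℓ T k F i a t ≤ (1 + odds p ℓ k i a t) * _ :=
        mul_le_mul_of_nonneg_left hsum hpos.le
    _ = T - t := by
        simp only [hS]
        field_simp
        ring

theorem phaseValue_step (p : ExpertParams I) (ℓ : ℕ → I → Bool) {T : ℕ} (k : ℕ) (F : ℕ → ℝ) (i : I)
    (a : ℕ) {t : ℕ} (ht : t < T) :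
    phaseValue p ℓ T k F i a t = (ℓ t i).toNat
      + keepProb p ℓ k i a t * phaseValue p ℓ T k F i a (t + 1)
      + (1 - keepProb p ℓ k i a t) * F (t + 1) := by
  have h1 := odds_pos p ℓ k i a t
  have h2 := odds_pos p ℓ k i a (t + 1)
  rw [phaseValue, Finset.sum_eq_sum_Ico_succ_bot ht, phaseValue, keepProb]
  field_simp
  ring

variable [Fintype I]

theorem totalWt_pos (p : ExpertParams I) (ℓ : ℕ → I → Bool) (t : ℕ) : 0 < totalWt p ℓ t :=
  Finset.sum_pos (fun i _ => wt_pos p ℓ t i) ⟨p.first, Finset.mem_univ _⟩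

theorem totalWt_anti (p : ExpertParams I) (ℓ : ℕ → I → Bool) : Antitone (totalWt p ℓ) := by
  intro s t h
  refine Finset.sum_le_sum fun i _ => Real.exp_le_exp.2 (neg_le_neg ?_)
  exact mul_le_mul_of_nonneg_left (Nat.cast_le.2 (cnt_mono ℓ i 0 h)) p.rate_nonneg

theorem totalWt_le_card (p : ExpertParams I) (ℓ : ℕ → I → Bool) (t : ℕ) :
    totalWt p ℓ t ≤ Fintype.card I := by
  refine (totalWt_anti p ℓ (Nat.zero_le t)).trans (le_of_eq ?_)
  simp [totalWt, wt, cnt]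

/-- This is how realizability enters the mistake analysis: the consistent expert is never
discounted. -/
theorem one_le_totalWt (p : ExpertParams I) {ℓ : ℕ → I → Bool} {i : I} {T : ℕ}
    (h : ∀ r < T, ℓ r i = false) {t : ℕ} (ht : t ≤ T) : 1 ≤ totalWt p ℓ t := by
  have : wt p ℓ t i = 1 := by
    have : cnt ℓ i 0 t = 0 := Finset.sum_eq_zero fun r hr => by
      simp [h r (by simp at hr; lia)]
    simp [wt, this]
  rw [← this]
  exact Finset.single_le_sum (f := wt p ℓ t) (fun j _ => (wt_pos p ℓ t j).le) (Finset.mem_univ i)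

theorem sum_wt_div (p : ExpertParams I) (ℓ : ℕ → I → Bool) (t : ℕ) :
    ∑ i, wt p ℓ t i / totalWt p ℓ t = 1 := by
  rw [← Finset.sum_div]
  exact div_self (totalWt_pos p ℓ t).ne'

/-- The probability of the next decision after a history. -/
noncomputable def decisionProb (p : ExpertParams I) (ℓ : ℕ → I → Bool) (l : List (Option I)) :
    Option I → ℝ
  | none => keepProb p ℓ (switchesLeft p l) (curExpert p l) (phaseStart p l) l.length
  | some j => (1 - keepProb p ℓ (switchesLeft p l) (curExpert p l) (phaseStart p l) l.length) *
      (wt p ℓ (l.length + 1) j / totalWt p ℓ (l.length + 1))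

theorem decisionProb_nonneg (p : ExpertParams I) (ℓ : ℕ → I → Bool) (l : List (Option I))
    (d : Option I) : 0 ≤ decisionProb p ℓ l d := by
  cases d with
  | none => exact (keepProb_pos ..).le
  | some j =>
    exact mul_nonneg (sub_nonneg.2 (keepProb_le_one ..))
      (div_nonneg (wt_pos ..).le (totalWt_pos ..).le)

theorem sum_decisionProb (p : ExpertParams I) (ℓ : ℕ → I → Bool) (l : List (Option I)) :
    ∑ d, decisionProb p ℓ l d = 1 := by
  rw [Fintype.sum_option]
  simp only [decisionProb]
  rw [← Finset.mul_sum, sum_wt_div]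
  ring

/-- The law of the next decision after a history. -/
noncomputable def decisionLaw (p : ExpertParams I) (ℓ : ℕ → I → Bool) (l : List (Option I)) :
    PMF (Option I) :=
  PMF.ofFintype (fun d => ENNReal.ofReal (decisionProb p ℓ l d)) (by
    rw [← ENNReal.ofReal_sum_of_nonneg fun d _ => decisionProb_nonneg p ℓ l d, sum_decisionProb,
      ENNReal.ofReal_one])

theorem decisionLaw_apply (p : ExpertParams I) (ℓ : ℕ → I → Bool) (l : List (Option I))
    (d : Option I) : decisionLaw p ℓ l d = ENNReal.ofReal (decisionProb p ℓ l d) := rfl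

/-! #### Expected number of mistakes -/

/-- Expected mistakes from round `t` on if the `k`-th last switch happens just before round `t`. -/
noncomputable def switchValue (p : ExpertParams I) (ℓ : ℕ → I → Bool) (T : ℕ) : ℕ → ℕ → ℝ
  | 0, _ => 0
  | k + 1, t => ∑ i, wt p ℓ t i / totalWt p ℓ t * phaseValue p ℓ T k (switchValue p ℓ T k) i t t

theorem switchValue_nonneg (p : ExpertParams I) (ℓ : ℕ → I → Bool) (T k t : ℕ) :
    0 ≤ switchValue p ℓ T k t := by
  induction k generalizing t with
  | zero => exact le_rfl
  | succ k ih =>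
    exact Finset.sum_nonneg fun i _ => mul_nonneg (div_nonneg (wt_pos ..).le (totalWt_pos ..).le)
      (phaseValue_nonneg p ℓ T k ih i t t)

theorem switchValue_le_horizon (p : ExpertParams I) (ℓ : ℕ → I → Bool) (T k : ℕ) {t : ℕ}
    (ht : t ≤ T) : switchValue p ℓ T k t ≤ T - t := by
  induction k generalizing t with
  | zero => simpa [switchValue] using ht
  | succ k ih =>
    calc switchValue p ℓ T (k + 1) t ≤ ∑ i, wt p ℓ t i / totalWt p ℓ t * ((T : ℝ) - t) :=
          Finset.sum_le_sum fun i _ => mul_le_mul_of_nonneg_left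
            (phaseValue_le_horizon p ℓ T k (fun t ht => ih ht) i t ht)
            (div_nonneg (wt_pos ..).le (totalWt_pos ..).le)
      _ = T - t := by rw [← Finset.sum_mul, sum_wt_div, one_mul]

/-- The Bellman equation of the learner. If no switch is left, the odds vanish and switching has
probability zero, so the truncated subtraction in the state is harmless. -/
theorem expectedValue_step (p : ExpertParams I) (ℓ : ℕ → I → Bool) {T : ℕ} (l : List (Option I))
    (hl : l.length < T) :
    let G := fun l : List (Option I) => phaseValue p ℓ T (switchesLeft p l)
      (switchValue p ℓ T (switchesLeft p l)) (curExpert p l) (phaseStart p l) l.length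
    ((ℓ l.length (curExpert p l)).toNat : ℝ) + ∑ d, decisionProb p ℓ l d * G (d :: l) = G l := by
  intro G
  rw [Fintype.sum_option]
  have hnone : G (none :: l) = phaseValue p ℓ T (switchesLeft p l)
      (switchValue p ℓ T (switchesLeft p l)) (curExpert p l) (phaseStart p l) (l.length + 1) := rfl
  have hsome : ∀ j, G (some j :: l) = phaseValue p ℓ T (switchesLeft p l - 1)
      (switchValue p ℓ T (switchesLeft p l - 1)) j (l.length + 1) (l.length + 1) := fun j => rfl
  simp only [hnone, hsome, decisionProb]
  simp only [G]
  rw [phaseValue_step p ℓ _ _ _ _ hl, add_assoc]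
  congr 2
  simp_rw [mul_assoc]
  rw [← Finset.mul_sum]
  rcases Nat.eq_zero_or_pos (switchesLeft p l) with h0 | h0
  · rw [h0]
    simp [keepProb, odds_zero]
  · obtain ⟨k, hk⟩ : ∃ k, switchesLeft p l = k + 1 := ⟨_, (Nat.succ_pred_eq_of_pos h0).symm⟩
    rw [hk, Nat.add_sub_cancel]
    rfl

theorem lintegral_mistakes_le (p : ExpertParams I) [MeasurableSpace (Option I)]
    [MeasurableSingletonClass (Option I)] (ℓ : ℕ → I → Bool) (T : ℕ) :
    ∫⁻ ω, ∑ t ∈ Finset.range T,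
        (if ℓ t (curExpert p (run (decisionLaw p ℓ) ω t)) then (1 : ℝ≥0∞) else 0) ∂sampler (Option I)
      ≤ ENNReal.ofReal
        (phaseValue p ℓ T p.switches (switchValue p ℓ T p.switches) p.first 0 0) := by
  have h := lintegral_cost_le (decisionLaw p ℓ) T
    (fun l => ENNReal.ofReal (ℓ l.length (curExpert p l)).toNat)
    (fun l => ENNReal.ofReal (phaseValue p ℓ T (switchesLeft p l)
      (switchValue p ℓ T (switchesLeft p l)) (curExpert p l) (phaseStart p l) l.length)) ?_
  · refine le_trans (le_of_eq ?_) h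
    refine lintegral_congr fun ω => Finset.sum_congr rfl fun t _ => ?_
    rw [length_run]
    cases ℓ t (curExpert p (run (decisionLaw p ℓ) ω t)) <;> simp
  · intro l hl
    have hG : ∀ l : List (Option I), 0 ≤ phaseValue p ℓ T (switchesLeft p l)
        (switchValue p ℓ T (switchesLeft p l)) (curExpert p l) (phaseStart p l) l.length :=
      fun l => phaseValue_nonneg p ℓ T _ (switchValue_nonneg p ℓ T _) _ _ _
    simp only [decisionLaw_apply]
    simp_rw [← ENNReal.ofReal_mul (decisionProb_nonneg p ℓ l _)]
    rw [← ENNReal.ofReal_sum_of_nonneg fun d _ => mul_nonneg (decisionProb_nonneg p ℓ l d) (hG _),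
      ← ENNReal.ofReal_add (Nat.cast_nonneg _)
        (Finset.sum_nonneg fun d _ => mul_nonneg (decisionProb_nonneg p ℓ l d) (hG _)),
      expectedValue_step p ℓ l hl]

end Experts
-- Mistake bound for the lazy expert learner
section Utility

variable {I : Type}

/-- The choice of `M` makes the odds increment equal to one at `M` mistakes. The first `M` mistakes
are charged in full; afterwards the latest increment alone forces the survival probability to decay
geometrically in the mistake count. -/
theorem sum_mistakes_div_le (p : ExpertParams I) (ℓ : ℕ → I → Bool) {k M : ℕ} (hk : k ≠ 0)
    (hq : 1 < p.base) (hM : p.scale * p.base ^ M = 1) (i : I) (a T : ℕ) :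
    ∑ r ∈ Finset.Ico a T, ((ℓ r i).toNat : ℝ) / (1 + odds p ℓ k i a r)
      ≤ M + p.base / (p.base - 1) := by
  have hq0 : 0 < p.base := zero_lt_one.trans hq
  set b : ℕ → ℝ := fun n => if n < M then 1 else (p.base⁻¹) ^ (n - M) with hb
  have hb0 : ∀ n, 0 ≤ b n := fun n => by
    simp only [hb]; split_ifs <;> positivity
  have hterm : ∀ t, a ≤ t → 1 / (1 + odds p ℓ k i a t) ≤ b (cnt ℓ i a t) := by
    intro t ht
    rw [div_le_iff₀ (odds_pos ..)]
    have h0 := odds_nonneg p ℓ k i a t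
    simp only [hb]
    split_ifs with h
    · linarith
    · push Not at h
      rcases ht.eq_or_lt with rfl | hlt
      · have : cnt ℓ i a a = 0 := by simp [cnt]
        rw [this]; simp [h0]
      · obtain ⟨s, rfl⟩ : ∃ s, t = s + 1 := ⟨t - 1, by lia⟩
        have h1 : inc p ℓ i a s ≤ odds p ℓ k i a (s + 1) := by
          rw [odds_succ p ℓ hk i (by lia : a ≤ s)]
          linarith [odds_nonneg p ℓ k i a s]
        have h2 : inc p ℓ i a s = p.base ^ (cnt ℓ i a (s + 1) - M) := by
          rw [inc, ← Nat.sub_add_cancel h, pow_add, Nat.add_sub_cancel, mul_comm, mul_assoc,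
            mul_comm _ p.scale, hM, mul_one]
        have h3 : (0 : ℝ) < p.base⁻¹ ^ (cnt ℓ i a (s + 1) - M) := by positivity
        have h4 : p.base⁻¹ ^ (cnt ℓ i a (s + 1) - M) * inc p ℓ i a s = 1 := by
          rw [h2, ← mul_pow, inv_mul_cancel₀ hq0.ne', one_pow]
        nlinarith
  have hind : ∀ t, a ≤ t → ∑ r ∈ Finset.Ico a t, ((ℓ r i).toNat : ℝ) / (1 + odds p ℓ k i a r)
      ≤ ∑ n ∈ Finset.range (cnt ℓ i a t), b n := by
    intro t ht
    induction t, ht using Nat.le_induction with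
    | base => simp [cnt]
    | succ t ht ih =>
      have hc : cnt ℓ i a (t + 1) = cnt ℓ i a t + (ℓ t i).toNat := Finset.sum_Ico_succ_top ht _
      rw [Finset.sum_Ico_succ_top ht, hc]
      cases h : ℓ t i
      · simpa using ih
      · simp only [Bool.toNat_true, Finset.sum_range_succ, Nat.cast_one]
        exact add_le_add ih (hterm t ht)
  have hgeom : ∀ n, ∑ j ∈ Finset.range n, b j ≤ M + p.base / (p.base - 1) := by
    intro n
    have hinv : p.base⁻¹ < 1 := inv_lt_one_of_one_lt₀ hq
    calc ∑ j ∈ Finset.range n, b j ≤ ∑ j ∈ Finset.range (M + n), b j :=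
          Finset.sum_le_sum_of_subset_of_nonneg (Finset.range_subset_range.2 (by lia))
            fun j _ _ => hb0 j
      _ = M + ∑ j ∈ Finset.range n, p.base⁻¹ ^ j := by
          rw [Finset.sum_range_add]
          congr 1
          · rw [Finset.sum_congr rfl fun j hj => by
              simp only [hb]; exact if_pos (Finset.mem_range.1 hj)]
            simp
          · exact Finset.sum_congr rfl fun j _ => by simp [hb]
      _ ≤ M + ∑' j, p.base⁻¹ ^ j := by
          gcongr
          exact (summable_geometric_of_lt_one (by positivity) hinv).sum_le_tsum _
            fun j _ => by positivity
      _ = M + p.base / (p.base - 1) := by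
          rw [tsum_geometric_of_lt_one (by positivity) hinv]
          have : p.base - 1 ≠ 0 := by linarith
          field_simp
  rcases le_total a T with h | h
  · exact (hind T h).trans (hgeom _)
  · rw [Finset.Ico_eq_empty_of_le h, Finset.sum_empty]
    exact add_nonneg (Nat.cast_nonneg _) (div_nonneg hq0.le (by linarith))

theorem hazard_le_inc (p : ExpertParams I) (ℓ : ℕ → I → Bool) {k : ℕ} (hk : k ≠ 0) (i : I)
    {a r : ℕ} (h : a ≤ r) :
    (1 + odds p ℓ k i a r)⁻¹ - (1 + odds p ℓ k i a (r + 1))⁻¹ ≤ inc p ℓ i a r := by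
  have h1 := odds_pos p ℓ k i a r
  have h2 := odds_pos p ℓ k i a (r + 1)
  have h3 := odds_nonneg p ℓ k i a r
  have h4 := odds_nonneg p ℓ k i a (r + 1)
  have h5 := odds_succ p ℓ hk i h
  have h6 := inc_pos p ℓ i a r
  rw [inv_sub_inv h1.ne' h2.ne', div_le_iff₀ (mul_pos h1 h2)]
  have h7 : (1 : ℝ) ≤ (1 + odds p ℓ k i a r) * (1 + odds p ℓ k i a (r + 1)) := by nlinarith
  nlinarith

theorem sum_hazard_le_one (p : ExpertParams I) (ℓ : ℕ → I → Bool) (k : ℕ) (i : I) (a T : ℕ) :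
    ∑ r ∈ Finset.Ico a T, ((1 + odds p ℓ k i a r)⁻¹ - (1 + odds p ℓ k i a (r + 1))⁻¹) ≤ 1 := by
  rcases le_total a T with h | h
  · have := Finset.sum_Ico_sub (fun r => -(1 + odds p ℓ k i a r)⁻¹) h
    rw [Finset.sum_congr rfl fun r _ => (by ring :
      (1 + odds p ℓ k i a r)⁻¹ - (1 + odds p ℓ k i a (r + 1))⁻¹
        = -(1 + odds p ℓ k i a (r + 1))⁻¹ - -(1 + odds p ℓ k i a r)⁻¹), this, odds_self]
    have := inv_pos.2 (odds_pos p ℓ k i a T)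
    simp only [add_zero, inv_one]
    linarith
  · simp [Finset.Ico_eq_empty_of_le h]

theorem phaseValue_self_le (p : ExpertParams I) (ℓ : ℕ → I → Bool) {k M : ℕ} (hk : k ≠ 0)
    (hq : 1 < p.base) (hM : p.scale * p.base ^ M = 1) (i : I) (a T : ℕ) (F : ℕ → ℝ) :
    phaseValue p ℓ T k F i a a ≤ M + p.base / (p.base - 1) + ∑ r ∈ Finset.Ico a T,
      ((1 + odds p ℓ k i a r)⁻¹ - (1 + odds p ℓ k i a (r + 1))⁻¹) * F (r + 1) := by
  rw [phaseValue, odds_self, Finset.sum_add_distrib, add_zero, one_mul]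
  exact add_le_add (sum_mistakes_div_le p ℓ hk hq hM i a T) le_rfl

theorem wt_add (p : ExpertParams I) (ℓ : ℕ → I → Bool) (i : I) {s t : ℕ} (h : s ≤ t) :
    wt p ℓ t i = wt p ℓ s i * Real.exp (-(p.rate * cnt ℓ i s t)) := by
  rw [wt, wt, ← Real.exp_add, ← cnt_add ℓ i (Nat.zero_le s) h]
  push_cast
  ring_nf

open Classical in
/-- The discount of expert `j` at the moment at which expert `i` reaches `m` mistakes. -/
noncomputable def raceDiscount (p : ExpertParams I) (ℓ : ℕ → I → Bool) (m t T : ℕ) (i j : I) : ℝ :=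
  if ∀ r ≤ T, m ≤ cnt ℓ i t r → m ≤ cnt ℓ j t r then Real.exp (-(p.rate * m)) else 1

theorem raceDiscount_nonneg (p : ExpertParams I) (ℓ : ℕ → I → Bool) (m t T : ℕ) (i j : I) :
    0 ≤ raceDiscount p ℓ m t T i j := by
  unfold raceDiscount; split_ifs <;> positivity

/-- If neither discount applied, each expert would reach `m` mistakes strictly before the other,
against monotonicity of the counts. -/
theorem raceDiscount_add_le (p : ExpertParams I) (ℓ : ℕ → I → Bool) (m t T : ℕ) (i j : I) :
    raceDiscount p ℓ m t T i j + raceDiscount p ℓ m t T j i ≤ 1 + Real.exp (-(p.rate * m)) := by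
  have hexp : Real.exp (-(p.rate * m)) ≤ 1 :=
    Real.exp_le_one_iff.2 (neg_nonpos.2 (mul_nonneg p.rate_nonneg (Nat.cast_nonneg _)))
  unfold raceDiscount
  split_ifs with h1 h2 h2
  · linarith
  · linarith
  · linarith
  · exfalso
    push Not at h1 h2
    obtain ⟨r, -, hr1, hr2⟩ := h1
    obtain ⟨s, -, hs1, hs2⟩ := h2
    rcases le_total r s with h | h
    · have := cnt_mono ℓ i t h; lia
    · have := cnt_mono ℓ j t h; lia

variable [Fintype I]

theorem totalWt_le_race (p : ExpertParams I) (ℓ : ℕ → I → Bool) {m t T : ℕ} (i : I) {s : ℕ}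
    (hts : t ≤ s) (hs : s ≤ T) (hi : m ≤ cnt ℓ i t s) :
    totalWt p ℓ s ≤ ∑ j, wt p ℓ t j * raceDiscount p ℓ m t T i j := by
  refine Finset.sum_le_sum fun j _ => ?_
  rw [wt_add p ℓ j hts]
  refine mul_le_mul_of_nonneg_left ?_ (wt_pos ..).le
  unfold raceDiscount
  split_ifs with h
  · refine Real.exp_le_exp.2 (neg_le_neg (mul_le_mul_of_nonneg_left ?_ p.rate_nonneg))
    exact Nat.cast_le.2 (h s hs hi)
  · exact Real.exp_le_one_iff.2 (neg_nonpos.2 (mul_nonneg p.rate_nonneg (Nat.cast_nonneg _)))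

/-- Symmetrize the double sum over the followed expert `i` and the competitor `j`: both carry the
same weights, so the race bound may be averaged over the two orders. -/
theorem sum_race_le (p : ExpertParams I) (ℓ : ℕ → I → Bool) (m t T : ℕ) :
    ∑ i, wt p ℓ t i / totalWt p ℓ t * ∑ j, wt p ℓ t j * raceDiscount p ℓ m t T i j
      ≤ (1 + Real.exp (-(p.rate * m))) / 2 * totalWt p ℓ t := by
  have hW := totalWt_pos p ℓ t
  have h1 : ∑ i, ∑ j, wt p ℓ t i * wt p ℓ t j * raceDiscount p ℓ m t T i j
      = ∑ i, ∑ j, wt p ℓ t i * wt p ℓ t j * raceDiscount p ℓ m t T j i := by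
    rw [Finset.sum_comm]
    exact Finset.sum_congr rfl fun i _ => Finset.sum_congr rfl fun j _ => by ring
  have h2 : ∑ i, ∑ j, wt p ℓ t i * wt p ℓ t j * raceDiscount p ℓ m t T i j
      + ∑ i, ∑ j, wt p ℓ t i * wt p ℓ t j * raceDiscount p ℓ m t T j i
      ≤ ∑ i, ∑ j, wt p ℓ t i * wt p ℓ t j * (1 + Real.exp (-(p.rate * m))) := by
    rw [← Finset.sum_add_distrib]
    refine Finset.sum_le_sum fun i _ => ?_
    rw [← Finset.sum_add_distrib]
    refine Finset.sum_le_sum fun j _ => ?_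
    rw [← mul_add]
    exact mul_le_mul_of_nonneg_left (raceDiscount_add_le ..) (mul_pos (wt_pos ..) (wt_pos ..)).le
  have h3 : ∑ i, ∑ j, wt p ℓ t i * wt p ℓ t j * (1 + Real.exp (-(p.rate * m)))
      = totalWt p ℓ t * totalWt p ℓ t * (1 + Real.exp (-(p.rate * m))) := by
    simp_rw [← Finset.sum_mul, ← Finset.mul_sum]
    rw [← Finset.sum_mul]
    rfl
  have h4 : ∑ i, wt p ℓ t i / totalWt p ℓ t * ∑ j, wt p ℓ t j * raceDiscount p ℓ m t T i j
      = (∑ i, ∑ j, wt p ℓ t i * wt p ℓ t j * raceDiscount p ℓ m t T i j) / totalWt p ℓ t := by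
    rw [Finset.sum_div]
    refine Finset.sum_congr rfl fun i _ => ?_
    rw [Finset.mul_sum, Finset.sum_div]
    exact Finset.sum_congr rfl fun j _ => by ring
  rw [h4, div_le_iff₀ hW]
  nlinarith

/-- Induction on the switches left, with the total weight as potential. The three terms are the
mistakes within phases, the horizon damped by one race factor per switch, and the cost of leaving
experts prematurely. Without switches, the trivial bound `T` is absorbed since the total weight is
at least one. -/
theorem switchValue_le (p : ExpertParams I) {ℓ : ℕ → I → Bool} {m M T : ℕ} {i₀ : I}
    (hreal : ∀ r < T, ℓ r i₀ = false) (hq : 1 < p.base) (hM : p.scale * p.base ^ M = 1)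
    (k : ℕ) {t : ℕ} (ht : t ≤ T) :
    switchValue p ℓ T (k + 1) t ≤ k * (M + p.base / (p.base - 1))
      + T * ((1 + Real.exp (-(p.rate * m))) / 2) ^ k * totalWt p ℓ t
      + k * (T * (T * (p.scale * p.base ^ m))) := by
  set B : ℝ := M + p.base / (p.base - 1) with hB
  set θ : ℝ := (1 + Real.exp (-(p.rate * m))) / 2 with hθ
  set δ : ℝ := p.scale * p.base ^ m with hδ
  have hB0 : 0 ≤ B := add_nonneg (Nat.cast_nonneg _)
    (div_nonneg (by linarith) (by linarith))
  have hθ0 : 0 ≤ θ := by positivity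
  have hδ0 : 0 ≤ δ := mul_nonneg p.scale_pos.le (pow_nonneg (by linarith) _)
  induction k generalizing t with
  | zero =>
    have h1 := switchValue_le_horizon p ℓ T (0 + 1) ht
    have h2 := one_le_totalWt p hreal ht
    have h3 : (0 : ℝ) ≤ T := Nat.cast_nonneg _
    have h4 : (0 : ℝ) ≤ t := Nat.cast_nonneg _
    simp only [Nat.cast_zero, zero_mul, zero_add, pow_zero, mul_one, add_zero] at *
    nlinarith
  | succ k ih =>
    set Z : I → ℝ := fun i => k * B
      + T * θ ^ k * ∑ j, wt p ℓ t j * raceDiscount p ℓ m t T i j + k * (T * (T * δ)) with hZ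
    have hZ0 : ∀ i, 0 ≤ Z i := fun i => by
      have : 0 ≤ ∑ j, wt p ℓ t j * raceDiscount p ℓ m t T i j :=
        Finset.sum_nonneg fun j _ => mul_nonneg (wt_pos ..).le (raceDiscount_nonneg ..)
      positivity
    have hphase : ∀ i, phaseValue p ℓ T (k + 1) (switchValue p ℓ T (k + 1)) i t t
        ≤ B + T * (T * δ) + Z i := by
      intro i
      have hsum : ∑ r ∈ Finset.Ico t T,
          ((1 + odds p ℓ (k + 1) i t r)⁻¹ - (1 + odds p ℓ (k + 1) i t (r + 1))⁻¹)
            * switchValue p ℓ T (k + 1) (r + 1) ≤ T * (T * δ) + Z i := by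
        calc _ ≤ ∑ r ∈ Finset.Ico t T, (T * δ
            + ((1 + odds p ℓ (k + 1) i t r)⁻¹ - (1 + odds p ℓ (k + 1) i t (r + 1))⁻¹) * Z i) := by
              refine Finset.sum_le_sum fun r hr => ?_
              obtain ⟨hr1, hr2⟩ := Finset.mem_Ico.1 hr
              have hg0 := hazard_nonneg p ℓ (k + 1) i t r
              have hg := hazard_le_inc p ℓ k.succ_ne_zero i hr1
              -- Before `m` mistakes the hazard is at most `δ`, and the remaining value is bounded
              -- trivially by `T`. From `m` mistakes on, the total weight is controlled by the race,
              -- uniformly in the leaving time `r`.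
              rcases lt_or_ge (cnt ℓ i t (r + 1)) m with hc | hc
              · have h1 : inc p ℓ i t r ≤ δ := mul_le_mul_of_nonneg_left
                  (pow_le_pow_right₀ hq.le hc.le) p.scale_pos.le
                have h2 := switchValue_le_horizon p ℓ T (k + 1) (t := r + 1) hr2
                have h3 : switchValue p ℓ T (k + 1) (r + 1) ≤ T := h2.trans (by
                  have : (0 : ℝ) ≤ (r + 1 : ℕ) := Nat.cast_nonneg _
                  linarith)
                have h4 := mul_nonneg hg0 (hZ0 i)
                have h5 := mul_le_mul (hg.trans h1) h3 (switchValue_nonneg ..) hδ0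
                linarith
              · have h1 : switchValue p ℓ T (k + 1) (r + 1) ≤ Z i := by
                  refine (ih (t := r + 1) hr2).trans ?_
                  simp only [hZ]
                  gcongr
                  exact totalWt_le_race p ℓ i (by lia) hr2 hc
                have h2 := mul_le_mul_of_nonneg_left h1 hg0
                have h3 : 0 ≤ T * δ := by positivity
                linarith
          _ ≤ T * (T * δ) + Z i := by
              rw [Finset.sum_add_distrib]
              refine add_le_add ?_ ?_
              · rw [Finset.sum_const, Nat.card_Ico, nsmul_eq_mul]
                gcongr
                lia
              · rw [← Finset.sum_mul]
                exact mul_le_of_le_one_left (hZ0 i) (sum_hazard_le_one ..)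
      have := phaseValue_self_le p ℓ k.succ_ne_zero hq hM i t T (switchValue p ℓ T (k + 1))
      linarith
    calc switchValue p ℓ T (k + 1 + 1) t
        ≤ ∑ i, wt p ℓ t i / totalWt p ℓ t * (B + T * (T * δ) + Z i) :=
          Finset.sum_le_sum fun i _ => mul_le_mul_of_nonneg_left (hphase i)
            (div_nonneg (wt_pos ..).le (totalWt_pos ..).le)
      _ = (B + T * (T * δ) + k * B + k * (T * (T * δ))) * ∑ i, wt p ℓ t i / totalWt p ℓ t
          + T * θ ^ k * ∑ i, wt p ℓ t i / totalWt p ℓ t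
            * ∑ j, wt p ℓ t j * raceDiscount p ℓ m t T i j := by
          rw [Finset.mul_sum, Finset.mul_sum, ← Finset.sum_add_distrib]
          exact Finset.sum_congr rfl fun i _ => by simp only [hZ]; ring
      _ ≤ (B + T * (T * δ) + k * B + k * (T * (T * δ))) * 1
          + T * θ ^ k * (θ * totalWt p ℓ t) := by
          rw [sum_wt_div]
          have := sum_race_le p ℓ m t T
          gcongr
      _ = _ := by push_cast; ring

/-- The initial expert is arbitrary rather than drawn from the weights, so its phase gains no race
factor and only adds one more phase cost. -/
theorem initialValue_le (p : ExpertParams I) {ℓ : ℕ → I → Bool} {k m M T : ℕ} {i₀ : I}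
    (hreal : ∀ r < T, ℓ r i₀ = false) (hk : p.switches = k + 1) (hq : 1 < p.base)
    (hM : p.scale * p.base ^ M = 1) :
    phaseValue p ℓ T p.switches (switchValue p ℓ T p.switches) p.first 0 0
      ≤ (k + 1) * (M + p.base / (p.base - 1))
      + T * ((1 + Real.exp (-(p.rate * m))) / 2) ^ k * Fintype.card I
      + k * (T * (T * (p.scale * p.base ^ m))) := by
  rw [hk]
  set Z : ℝ := k * (M + p.base / (p.base - 1))
      + T * ((1 + Real.exp (-(p.rate * m))) / 2) ^ k * Fintype.card I
      + k * (T * (T * (p.scale * p.base ^ m))) with hZ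
  have hZ0 : 0 ≤ Z := by
    have h1 : 0 ≤ p.base / (p.base - 1) := div_nonneg (by linarith) (by linarith)
    have h2 := p.scale_pos
    have h3 : 0 < p.base := by linarith
    positivity
  have h1 := phaseValue_self_le p ℓ k.succ_ne_zero hq hM p.first 0 T (switchValue p ℓ T (k + 1))
  have h2 : ∑ r ∈ Finset.Ico 0 T,
      ((1 + odds p ℓ (k + 1) p.first 0 r)⁻¹ - (1 + odds p ℓ (k + 1) p.first 0 (r + 1))⁻¹)
        * switchValue p ℓ T (k + 1) (r + 1) ≤ Z := by
    calc _ ≤ ∑ r ∈ Finset.Ico 0 T, ((1 + odds p ℓ (k + 1) p.first 0 r)⁻¹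
          - (1 + odds p ℓ (k + 1) p.first 0 (r + 1))⁻¹) * Z := by
          refine Finset.sum_le_sum fun r hr => mul_le_mul_of_nonneg_left ?_ (hazard_nonneg ..)
          refine (switchValue_le p (m := m) hreal hq hM k (t := r + 1)
            (Finset.mem_Ico.1 hr).2).trans ?_
          simp only [hZ]
          gcongr
          exact totalWt_le_card ..
      _ ≤ Z := by
          rw [← Finset.sum_mul]
          exact mul_le_of_le_one_left hZ0 (sum_hazard_le_one ..)
  linarith

end Utility
-- Privacy of the decision history
section Privacy

variable {I : Type} {ℓ ℓ' : ℕ → I → Bool} {s : ℕ}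

theorem cnt_le_add_one (h : ∀ r, r ≠ s → ℓ r = ℓ' r) (i : I) (a t : ℕ) :
    cnt ℓ i a t ≤ cnt ℓ' i a t + 1 := by
  calc cnt ℓ i a t ≤ ∑ r ∈ Finset.Ico a t, ((ℓ' r i).toNat + if r = s then 1 else 0) := by
        refine Finset.sum_le_sum fun r _ => ?_
        by_cases hr : r = s
        · have := Bool.toNat_le (ℓ r i)
          rw [if_pos hr]; lia
        · rw [h r hr]; exact Nat.le_add_right _ _
    _ ≤ cnt ℓ' i a t + 1 := by
        rw [Finset.sum_add_distrib, Finset.sum_ite_eq']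
        refine Nat.add_le_add le_rfl ?_
        split_ifs <;> simp

theorem cnt_congr (h : ∀ r, r ≠ s → ℓ r = ℓ' r) (i : I) {a t : ℕ} (hs : s < a ∨ t ≤ s) :
    cnt ℓ i a t = cnt ℓ' i a t :=
  Finset.sum_congr rfl fun r hr => by
    have := Finset.mem_Ico.1 hr
    rw [h r (by lia)]

theorem inc_le (p : ExpertParams I) (h : ∀ r, r ≠ s → ℓ r = ℓ' r) (i : I) (a t : ℕ) :
    inc p ℓ i a t ≤ p.base * inc p ℓ' i a t := by
  calc inc p ℓ i a t ≤ p.scale * p.base ^ (cnt ℓ' i a (t + 1) + 1) :=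
        mul_le_mul_of_nonneg_left (pow_le_pow_right₀ p.one_le_base (cnt_le_add_one h ..))
          p.scale_pos.le
    _ = _ := by rw [inc]; ring

theorem inc_congr (p : ExpertParams I) (h : ∀ r, r ≠ s → ℓ r = ℓ' r) (i : I) {a t : ℕ}
    (hs : s < a ∨ t < s) : inc p ℓ i a t = inc p ℓ' i a t := by
  rw [inc, inc, cnt_congr h i (hs.imp id Nat.succ_le_of_lt)]

theorem one_add_odds_le (p : ExpertParams I) (h : ∀ r, r ≠ s → ℓ r = ℓ' r) (k : ℕ) (i : I)
    (a t : ℕ) : 1 + odds p ℓ k i a t ≤ p.base * (1 + odds p ℓ' k i a t) := by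
  have h1 := p.one_le_base
  unfold odds
  split_ifs
  · simpa using h1
  · rw [mul_add, mul_one, Finset.mul_sum]
    exact add_le_add h1 (Finset.sum_le_sum fun r _ => inc_le p h i a r)

theorem odds_congr (p : ExpertParams I) (h : ∀ r, r ≠ s → ℓ r = ℓ' r) (k : ℕ) (i : I) {a t : ℕ}
    (hs : s < a ∨ t ≤ s) : odds p ℓ k i a t = odds p ℓ' k i a t := by
  unfold odds
  split_ifs
  · rfl
  · refine Finset.sum_congr rfl fun r hr => inc_congr p h i ?_
    have := Finset.mem_Ico.1 hr
    lia

theorem wt_le (p : ExpertParams I) (h : ∀ r, r ≠ s → ℓ r = ℓ' r) (t : ℕ) (i : I) :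
    wt p ℓ t i ≤ Real.exp p.rate * wt p ℓ' t i := by
  rw [wt, wt, ← Real.exp_add]
  refine Real.exp_le_exp.2 ?_
  have h1 : (cnt ℓ' i 0 t : ℝ) ≤ cnt ℓ i 0 t + 1 := by
    exact_mod_cast cnt_le_add_one (fun r hr => (h r hr).symm) i 0 t
  have := mul_le_mul_of_nonneg_left h1 p.rate_nonneg
  linarith

theorem one_sub_keepProb (p : ExpertParams I) (ℓ : ℕ → I → Bool) {k : ℕ} (hk : k ≠ 0) (i : I)
    {a t : ℕ} (h : a ≤ t) :
    1 - keepProb p ℓ k i a t = inc p ℓ i a t / (1 + odds p ℓ k i a (t + 1)) := by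
  have := odds_pos p ℓ k i a (t + 1)
  rw [keepProb, eq_div_iff this.ne', sub_mul, div_mul_cancel₀ _ this.ne', odds_succ p ℓ hk i h]
  ring

/-- Number of factors `base` that the change of round `s` may have cost in completed phases. -/
def phaseCost (p : ExpertParams I) (s : ℕ) (l : List (Option I)) : ℕ :=
  if s < phaseStart p l then 3 else 0

theorem switchesLeft_le (p : ExpertParams I) (l : List (Option I)) :
    switchesLeft p l ≤ p.switches := by
  induction l with
  | nil => exact le_rfl
  | cons d l ih =>
    cases d with
    | none => exact ih
    | some j => exact (Nat.sub_le _ _).trans ih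

/-- A leaving probability equals `inc / ((1 + odds t) * (1 + odds (t + 1)))`. If the changed round
lies inside the phase being closed, each of the three quantities moves by a factor at most `base`;
otherwise none moves. -/
theorem hazard_ratio (p : ExpertParams I) (h : ∀ r, r ≠ s → ℓ r = ℓ' r)
    (l : List (Option I)) (j : I) (hk : switchesLeft p l ≠ 0) :
    (1 - keepProb p ℓ (switchesLeft p l) (curExpert p l) (phaseStart p l) l.length)
        / (1 + odds p ℓ (switchesLeft p l) (curExpert p l) (phaseStart p l) l.length)
        * p.base ^ phaseCost p s l
      ≤ p.base ^ phaseCost p s (some j :: l)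
        * ((1 - keepProb p ℓ' (switchesLeft p l) (curExpert p l) (phaseStart p l) l.length)
          / (1 + odds p ℓ' (switchesLeft p l) (curExpert p l) (phaseStart p l) l.length)) := by
  have ha := phaseStart_le p l
  have hstart : phaseStart p (some j :: l) = l.length + 1 := rfl
  rw [one_sub_keepProb p ℓ hk _ ha, one_sub_keepProb p ℓ' hk _ ha, div_div, div_div]
  generalize switchesLeft p l = k at *
  generalize curExpert p l = i at *
  have o1 := odds_pos p ℓ k i (phaseStart p l) l.length
  have o2 := odds_pos p ℓ k i (phaseStart p l) (l.length + 1)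
  have o3 := odds_pos p ℓ' k i (phaseStart p l) l.length
  have o4 := odds_pos p ℓ' k i (phaseStart p l) (l.length + 1)
  unfold phaseCost
  rw [hstart]
  rcases lt_or_ge s (phaseStart p l) with h1 | h1
  · rw [if_pos h1, if_pos (by lia), inc_congr p h i (.inl h1), odds_congr p h k i (.inl h1),
      odds_congr p h k i (.inl h1), mul_comm]
  · rcases lt_or_ge l.length s with h2 | h2
    · rw [if_neg (by lia), if_neg (by lia), inc_congr p h i (.inr h2),
        odds_congr p h k i (.inr h2.le), odds_congr p h k i (.inr h2), mul_comm]
    · rw [if_neg (by lia), if_pos (by lia), pow_zero, mul_one]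
      have h' : ∀ r, r ≠ s → ℓ' r = ℓ r := fun r hr => (h r hr).symm
      have e1 := inc_le p h i (phaseStart p l) l.length
      have e2 := one_add_odds_le p h' k i (phaseStart p l) l.length
      have e3 := one_add_odds_le p h' k i (phaseStart p l) (l.length + 1)
      have i1 := inc_pos p ℓ i (phaseStart p l) l.length
      have i2 := inc_pos p ℓ' i (phaseStart p l) l.length
      have q1 := p.one_le_base
      rw [← mul_div_assoc, div_le_div_iff₀ (by positivity) (by positivity)]
      calc inc p ℓ i (phaseStart p l) l.length * ((1 + odds p ℓ' k i (phaseStart p l) (l.length + 1))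
            * (1 + odds p ℓ' k i (phaseStart p l) l.length))
          ≤ (p.base * inc p ℓ' i (phaseStart p l) l.length)
            * ((p.base * (1 + odds p ℓ k i (phaseStart p l) (l.length + 1)))
            * (p.base * (1 + odds p ℓ k i (phaseStart p l) l.length))) := by gcongr
        _ = _ := by ring

variable [Fintype I]

theorem wt_div_le (p : ExpertParams I) (h : ∀ r, r ≠ s → ℓ r = ℓ' r) (t : ℕ) (i : I) :
    wt p ℓ t i / totalWt p ℓ t
      ≤ Real.exp (2 * p.rate) * (wt p ℓ' t i / totalWt p ℓ' t) := by
  have h1 : totalWt p ℓ' t ≤ Real.exp p.rate * totalWt p ℓ t := by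
    rw [totalWt, totalWt, Finset.mul_sum]
    exact Finset.sum_le_sum fun i _ => wt_le p (fun r hr => (h r hr).symm) t i
  have h2 := wt_le p h t i
  have h3 := totalWt_pos p ℓ t
  have h4 := totalWt_pos p ℓ' t
  have h5 := wt_pos p ℓ' t i
  rw [← mul_div_assoc, div_le_div_iff₀ h3 h4, two_mul, Real.exp_add]
  calc wt p ℓ t i * totalWt p ℓ' t
      ≤ (Real.exp p.rate * wt p ℓ' t i) * (Real.exp p.rate * totalWt p ℓ t) := by gcongr
    _ = _ := by ring

/-- The probability of a history of decisions. -/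
noncomputable def historyProb (p : ExpertParams I) (ℓ : ℕ → I → Bool) : List (Option I) → ℝ
  | [] => 1
  | d :: l => historyProb p ℓ l * decisionProb p ℓ l d

theorem historyProb_nonneg (p : ExpertParams I) (ℓ : ℕ → I → Bool) (l : List (Option I)) :
    0 ≤ historyProb p ℓ l := by
  induction l with
  | nil => exact zero_le_one
  | cons d l ih => exact mul_nonneg ih (decisionProb_nonneg ..)

theorem pathProb_decisionLaw (p : ExpertParams I) (ℓ : ℕ → I → Bool) (l : List (Option I)) :
    pathProb (decisionLaw p ℓ) l = ENNReal.ofReal (historyProb p ℓ l) := by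
  induction l with
  | nil => simp [pathProb, historyProb]
  | cons d l ih =>
    rw [pathProb, historyProb, ih, decisionLaw_apply,
      ENNReal.ofReal_mul (historyProb_nonneg p ℓ l)]

/-- Multiplying by the current `1 + odds` cancels the telescoping keep probabilities, so keeping an
expert is free and the loss accrues only at switches: `exp (2 * rate)` for each redraw, and `base ^
3` once, when the phase containing `s` closes. -/
theorem historyProb_mul_odds_le (p : ExpertParams I) (h : ∀ r, r ≠ s → ℓ r = ℓ' r)
    (l : List (Option I)) :
    historyProb p ℓ l
        * (1 + odds p ℓ (switchesLeft p l) (curExpert p l) (phaseStart p l) l.length)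
      ≤ p.base ^ phaseCost p s l * Real.exp (2 * p.rate) ^ (p.switches - switchesLeft p l)
        * (historyProb p ℓ' l
          * (1 + odds p ℓ' (switchesLeft p l) (curExpert p l) (phaseStart p l) l.length)) := by
  induction l with
  | nil => simp [historyProb, phaseCost, phaseStart, curExpert, switchesLeft, expertState, odds_self]
  | cons d l ih =>
    have o1 := odds_pos p ℓ (switchesLeft p l) (curExpert p l) (phaseStart p l) l.length
    have o2 := odds_pos p ℓ (switchesLeft p l) (curExpert p l) (phaseStart p l) (l.length + 1)
    have o3 := odds_pos p ℓ' (switchesLeft p l) (curExpert p l) (phaseStart p l) l.length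
    have o4 := odds_pos p ℓ' (switchesLeft p l) (curExpert p l) (phaseStart p l) (l.length + 1)
    have p1 := historyProb_nonneg p ℓ l
    have p2 := historyProb_nonneg p ℓ' l
    have q0 : 0 < p.base := zero_lt_one.trans_le p.one_le_base
    cases d with
    | none =>
      change historyProb p ℓ l * keepProb p ℓ (switchesLeft p l) (curExpert p l) (phaseStart p l)
          l.length * (1 + odds p ℓ (switchesLeft p l) (curExpert p l) (phaseStart p l)
          (l.length + 1)) ≤ p.base ^ phaseCost p s l
          * Real.exp (2 * p.rate) ^ (p.switches - switchesLeft p l)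
          * (historyProb p ℓ' l * keepProb p ℓ' (switchesLeft p l) (curExpert p l)
          (phaseStart p l) l.length * (1 + odds p ℓ' (switchesLeft p l) (curExpert p l)
          (phaseStart p l) (l.length + 1)))
      rw [keepProb, keepProb, mul_assoc, mul_assoc (historyProb p ℓ' l),
        div_mul_cancel₀ _ o2.ne', div_mul_cancel₀ _ o4.ne']
      exact ih
    | some j =>
      have k1 := sub_nonneg.2 (keepProb_le_one p ℓ (switchesLeft p l) (curExpert p l)
        (phaseStart p l) l.length)
      have k2 := sub_nonneg.2 (keepProb_le_one p ℓ' (switchesLeft p l) (curExpert p l)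
        (phaseStart p l) l.length)
      have w1 : 0 ≤ wt p ℓ (l.length + 1) j / totalWt p ℓ (l.length + 1) :=
        div_nonneg (wt_pos ..).le (totalWt_pos ..).le
      have w2 : 0 ≤ wt p ℓ' (l.length + 1) j / totalWt p ℓ' (l.length + 1) :=
        div_nonneg (wt_pos ..).le (totalWt_pos ..).le
      have hw := wt_div_le p h (l.length + 1) j
      have hr := hazard_ratio p h l j
      change historyProb p ℓ l * ((1 - keepProb p ℓ (switchesLeft p l) (curExpert p l)
          (phaseStart p l) l.length) * (wt p ℓ (l.length + 1) j / totalWt p ℓ (l.length + 1)))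
          * (1 + odds p ℓ (switchesLeft p l - 1) j (l.length + 1) (l.length + 1))
          ≤ p.base ^ phaseCost p s (some j :: l)
          * Real.exp (2 * p.rate) ^ (p.switches - (switchesLeft p l - 1))
          * (historyProb p ℓ' l * ((1 - keepProb p ℓ' (switchesLeft p l) (curExpert p l)
          (phaseStart p l) l.length) * (wt p ℓ' (l.length + 1) j / totalWt p ℓ' (l.length + 1)))
          * (1 + odds p ℓ' (switchesLeft p l - 1) j (l.length + 1) (l.length + 1)))
      rw [odds_self, odds_self, add_zero, mul_one, mul_one]
      rcases Nat.eq_zero_or_pos (switchesLeft p l) with h0 | h0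
      -- With no switch left, the history has probability zero on both sides.
      · rw [h0]
        simp [keepProb, odds_zero]
      · have hK := switchesLeft_le p l
        rw [show p.switches - (switchesLeft p l - 1) = p.switches - switchesLeft p l + 1 by lia,
          pow_succ]
        specialize hr h0.ne'
        generalize odds p ℓ (switchesLeft p l) (curExpert p l) (phaseStart p l) l.length = O at *
        generalize odds p ℓ' (switchesLeft p l) (curExpert p l) (phaseStart p l) l.length = O' at *
        generalize 1 - keepProb p ℓ (switchesLeft p l) (curExpert p l) (phaseStart p l) l.length
          = H at *
        generalize 1 - keepProb p ℓ' (switchesLeft p l) (curExpert p l) (phaseStart p l) l.length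
          = H' at *
        generalize wt p ℓ (l.length + 1) j / totalWt p ℓ (l.length + 1) = w at *
        generalize wt p ℓ' (l.length + 1) j / totalWt p ℓ' (l.length + 1) = w' at *
        generalize Real.exp (2 * p.rate) ^ (p.switches - switchesLeft p l) = E at *
        have hE : 0 < Real.exp (2 * p.rate) := Real.exp_pos _
        generalize Real.exp (2 * p.rate) = e at *
        have hq1 : 0 < p.base ^ phaseCost p s l := by positivity
        have hq2 : 0 < p.base ^ phaseCost p s (some j :: l) := by positivity
        generalize p.base ^ phaseCost p s l = c at *
        generalize p.base ^ phaseCost p s (some j :: l) = c' at *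
        generalize historyProb p ℓ l = x at *
        generalize historyProb p ℓ' l = x' at *
        have hE0 : 0 ≤ E * (x' * (1 + O')) := by
          have h1 : 0 ≤ x * (1 + O) := mul_nonneg p1 o1.le
          have h2 : 0 ≤ c * (E * (x' * (1 + O'))) := by linarith
          exact nonneg_of_mul_nonneg_right h2 hq1
        calc x * (H * w) = x * (1 + O) * (H / (1 + O)) * w := by field_simp
          _ ≤ c * E * (x' * (1 + O')) * (H / (1 + O)) * (e * w') := by
              gcongr
              have : 0 ≤ x * (1 + O) := mul_nonneg p1 o1.le
              have : 0 ≤ c * E * (x' * (1 + O')) := this.trans ih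
              positivity
          _ = E * (x' * (1 + O')) * (e * w') * (H / (1 + O) * c) := by ring
          _ ≤ E * (x' * (1 + O')) * (e * w') * (c' * (H' / (1 + O'))) := by gcongr
          _ = c' * (E * e) * (x' * (H' * w')) := by field_simp

/-- Removing the odds of the unfinished phase from the invariant costs the fourth factor `base`. -/
theorem historyProb_le (p : ExpertParams I) (h : ∀ r, r ≠ s → ℓ r = ℓ' r) (l : List (Option I)) :
    historyProb p ℓ l
      ≤ p.base ^ 4 * Real.exp (2 * p.rate) ^ p.switches * historyProb p ℓ' l := by
  have h1 := historyProb_mul_odds_le p h l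
  have h2 := one_add_odds_le p (fun r hr => (h r hr).symm) (switchesLeft p l) (curExpert p l)
    (phaseStart p l) l.length
  have o1 := odds_pos p ℓ (switchesLeft p l) (curExpert p l) (phaseStart p l) l.length
  have o2 := odds_pos p ℓ' (switchesLeft p l) (curExpert p l) (phaseStart p l) l.length
  have p1 := historyProb_nonneg p ℓ' l
  have q1 := p.one_le_base
  have q0 : 0 < p.base := zero_lt_one.trans_le q1
  have hc : p.base ^ phaseCost p s l ≤ p.base ^ 3 := by
    refine pow_le_pow_right₀ q1 ?_
    unfold phaseCost; split_ifs <;> simp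
  have he : Real.exp (2 * p.rate) ^ (p.switches - switchesLeft p l)
      ≤ Real.exp (2 * p.rate) ^ p.switches :=
    pow_le_pow_right₀ (Real.one_le_exp (by linarith [p.rate_nonneg])) (Nat.sub_le _ _)
  refine le_of_mul_le_mul_right (h1.trans ?_) o1
  calc _ ≤ p.base ^ 3 * Real.exp (2 * p.rate) ^ p.switches * (historyProb p ℓ' l
        * (p.base * (1 + odds p ℓ (switchesLeft p l) (curExpert p l) (phaseStart p l) l.length)))
        := by
          have := mul_nonneg p1 o2.le
          gcongr
    _ = _ := by ring

theorem sampler_decisions_le (p : ExpertParams I) [MeasurableSpace (Option I)]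
    [MeasurableSingletonClass (Option I)] (h : ∀ r, r ≠ s → ℓ r = ℓ' r) {ε : ℝ}
    (hε : p.base ^ 4 * Real.exp (2 * p.rate) ^ p.switches ≤ Real.exp ε) (T : ℕ)
    (B : Set (List (Option I))) :
    sampler (Option I) {ω | run (decisionLaw p ℓ) ω T ∈ B}
      ≤ ENNReal.ofReal (Real.exp ε)
        * sampler (Option I) {ω | run (decisionLaw p ℓ') ω T ∈ B} := by
  refine sampler_run_mem_le _ _ T _ (fun l _ => ?_) B
  rw [pathProb_decisionLaw, pathProb_decisionLaw, ← ENNReal.ofReal_mul (Real.exp_pos ε).le]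
  exact ENNReal.ofReal_le_ofReal ((historyProb_le p h l).trans
    (mul_le_mul_of_nonneg_right hε (historyProb_nonneg p ℓ' l)))

end Privacy
/-! ### The online learner obtained from a random list of experts -/

section Learner

variable {X : Type u} {I : Type}

theorem drop_run {α : Type} (P : List α → PMF α) (ω : ℕ × PMF α → α) (t k : ℕ) :
    (run P ω (t + k)).drop k = run P ω t := by
  induction k with
  | zero => simp
  | succ k ih => rw [← add_assoc, run, List.drop_succ_cons, ih]

/-- The mistakes of the experts `V` on the examples `S`, padded with `false`. -/
def losses {n : ℕ} (S : Fin n → X × Bool) (V : I → X → Bool) (r : ℕ) (i : I) : Bool :=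
  if h : r < n then V i (S ⟨r, h⟩).1 != (S ⟨r, h⟩).2 else false

theorem cnt_congr_of_lt {ℓ ℓ' : ℕ → I → Bool} {t : ℕ} (h : ∀ r < t, ℓ r = ℓ' r) (i : I) (a : ℕ) :
    cnt ℓ i a t = cnt ℓ' i a t :=
  Finset.sum_congr rfl fun r hr => by rw [h r (Finset.mem_Ico.1 hr).2]

theorem odds_congr_of_lt (p : ExpertParams I) {ℓ ℓ' : ℕ → I → Bool} {t : ℕ}
    (h : ∀ r < t, ℓ r = ℓ' r) (k : ℕ) (i : I) (a : ℕ) :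
    odds p ℓ k i a t = odds p ℓ' k i a t := by
  unfold odds
  split_ifs
  · rfl
  · refine Finset.sum_congr rfl fun r hr => ?_
    have hr := (Finset.mem_Ico.1 hr).2
    rw [inc, inc, cnt_congr_of_lt (fun r' hr' => h r' (by lia))]

variable [Fintype I]

theorem decisionLaw_congr (p : ExpertParams I) {ℓ ℓ' : ℕ → I → Bool} {l : List (Option I)}
    (h : ∀ r ≤ l.length, ℓ r = ℓ' r) : decisionLaw p ℓ l = decisionLaw p ℓ' l := by
  have h1 : ∀ r < l.length, ℓ r = ℓ' r := fun r hr => h r hr.le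
  have h2 : ∀ r < l.length + 1, ℓ r = ℓ' r := fun r hr => h r (by lia)
  have hw : wt p ℓ (l.length + 1) = wt p ℓ' (l.length + 1) :=
    funext fun i => by rw [wt, wt, cnt_congr_of_lt h2]
  have hk : ∀ k i a, keepProb p ℓ k i a l.length = keepProb p ℓ' k i a l.length := fun k i a => by
    rw [keepProb, keepProb, odds_congr_of_lt p h1, odds_congr_of_lt p h2]
  ext d
  rw [decisionLaw_apply, decisionLaw_apply]
  congr 1
  cases d with
  | none => exact hk _ _ _
  | some j => simp only [decisionProb, hk, hw, totalWt]

/-- The expert of the list `V` followed in round `t`. -/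
noncomputable def followed (p : ExpertParams I) {n : ℕ} (S : Fin n → X × Bool)
    (V : I → X → Bool) (ω : ℕ × PMF (Option I) → Option I) (t : ℕ) : I :=
  curExpert p (run (decisionLaw p (losses S V)) ω t)

theorem followed_castLE (p : ExpertParams I) {T t : ℕ} (ht : t ≤ T) (S : Fin T → X × Bool)
    (V : I → X → Bool) (ω : ℕ × PMF (Option I) → Option I) :
    followed p (fun s : Fin t => S (Fin.castLE ht s)) V ω t = followed p S V ω t := by
  unfold followed
  rw [run_congr ω (t := t) fun l hl => decisionLaw_congr p fun r hr => ?_]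
  funext i
  have h1 : r < t := by lia
  have h2 : r < T := by lia
  simp [losses, h1, h2, Fin.castLE]

theorem measurableSet_exists_consistent {T : ℕ} (S : Fin T → X × Bool) :
    MeasurableSet {V : I → X → Bool | ∃ i, ∀ t, V i (S t).1 = (S t).2} := by
  have : {V : I → X → Bool | ∃ i, ∀ t, V i (S t).1 = (S t).2}
      = ⋃ i, ⋂ t, (fun V : I → X → Bool => V i (S t).1) ⁻¹' {(S t).2} := by
    ext V; simp
  rw [this]
  exact MeasurableSet.iUnion fun i => MeasurableSet.iInter fun t =>
    ((measurable_pi_apply (S t).1).comp (measurable_pi_apply i)) (measurableSet_singleton _)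

variable [MeasurableSpace (Option I)] [MeasurableSingletonClass (Option I)]

/-- The choice of expert sees the list only through its finite table of predictions on the stream,
which reduces joint measurability to countably many cases. -/
theorem measurable_followed (p : ExpertParams I) {n : ℕ} (S : Fin n → X × Bool) (t : ℕ) :
    Measurable fun x : (I → X → Bool) × (ℕ × PMF (Option I) → Option I) =>
      x.1 (followed p S x.1 x.2 t) := by
  let _ : MeasurableSpace I := ⊤
  have : MeasurableSingletonClass I := ⟨fun _ => trivial⟩
  -- Points are replaced by their positions, so that the table itself plays the role of the list of
  -- experts.
  let S' : Fin n → Fin n × Bool := fun s => (s, (S s).2)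
  have hpat : Measurable fun (V : I → X → Bool) (i : I) (s : Fin n) => V i (S s).1 :=
    measurable_pi_lambda _ fun i => measurable_pi_lambda _ fun s =>
      (measurable_pi_apply (S s).1).comp (measurable_pi_apply i)
  have hg : Measurable fun y : (I → Fin n → Bool) × (ℕ × PMF (Option I) → Option I) =>
      followed p S' y.1 y.2 t :=
    measurable_from_prod_countable_right fun v =>
      measurable_run_comp (decisionLaw p (losses S' v)) t (curExpert p)
  have hfol : Measurable fun x : (I → X → Bool) × (ℕ × PMF (Option I) → Option I) =>
      followed p S x.1 x.2 t := by
    have hS : ∀ V : I → X → Bool, losses S' (fun i s => V i (S s).1) = losses S V := fun V => rfl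
    have := hg.comp ((hpat.comp measurable_fst).prodMk
      (measurable_snd (α := I → X → Bool) (β := ℕ × PMF (Option I) → Option I)))
    unfold followed at this ⊢
    simp only [Function.comp_def, hS] at this
    exact this
  have hev : Measurable fun z : (I → X → Bool) × I => z.1 z.2 :=
    measurable_from_prod_countable_left fun i => measurable_pi_apply i
  exact hev.comp (measurable_fst.prodMk hfol)

/-- The learner that draws a list of experts `V ∼ μ` and follows experts from this list. -/
noncomputable def expertLearner (p : ExpertParams I) (μ : Measure (I → X → Bool))
    [IsProbabilityMeasure μ] (T : ℕ) : OnlineLearner X T where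
  Ω := (I → X → Bool) × (ℕ × PMF (Option I) → Option I)
  μ := μ.prod (sampler (Option I))
  predict t past x := x.1 (followed p past x.1 x.2 t)
  measurable_predict t past := measurable_followed p past t

theorem expertLearner_outputs (p : ExpertParams I) (μ : Measure (I → X → Bool))
    [IsProbabilityMeasure μ] {T : ℕ} (S : Fin T → X × Bool) (V : I → X → Bool)
    (ω : ℕ × PMF (Option I) → Option I) (t : Fin T) :
    (expertLearner p μ T).outputs S (V, ω) t = V (followed p S V ω t) :=
  congrArg V (followed_castLE p t.isLt.le S V ω)

/-- The list is drawn independently of the data, so it may be fixed. All outputs are then a function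
of the final decision history, whose suffixes are the earlier histories. -/
theorem isPureDP_expertLearner (p : ExpertParams I) (μ : Measure (I → X → Bool))
    [IsProbabilityMeasure μ] (T : ℕ) {ε : ℝ}
    (hε : p.base ^ 4 * Real.exp (2 * p.rate) ^ p.switches ≤ Real.exp ε) :
    IsPureDP ε (expertLearner p μ T).law := by
  rintro S₁ S₂ ⟨s, hs⟩ O hO
  have hlaw : ∀ S, (expertLearner p μ T).law S O
      = ∫⁻ V, sampler (Option I) {ω | (expertLearner p μ T).outputs S (V, ω) ∈ O} ∂μ := fun S => by
    have hm := (expertLearner p μ T).measurable_outputs S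
    rw [OnlineLearner.law, Measure.map_apply hm hO]
    exact Measure.prod_apply (hm hO)
  rw [hlaw, hlaw, ← lintegral_const_mul' _ _ ENNReal.ofReal_ne_top]
  refine lintegral_mono fun V => ?_
  let B : Set (List (Option I)) := {l | (fun t : Fin T => V (curExpert p (l.drop (T - t)))) ∈ O}
  have hB : ∀ S, {ω | (expertLearner p μ T).outputs S (V, ω) ∈ O}
      = {ω | run (decisionLaw p (losses S V)) ω T ∈ B} := fun S => by
    ext ω
    have : (expertLearner p μ T).outputs S (V, ω) = fun t : Fin T => V (curExpert p
        ((run (decisionLaw p (losses S V)) ω T).drop (T - t))) := funext fun t => by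
      have h := drop_run (decisionLaw p (losses S V)) ω t (T - t)
      rw [Nat.add_sub_cancel' t.isLt.le] at h
      rw [expertLearner_outputs, h, followed]
    simp only [Set.mem_ofPred_eq, this, B]
  rw [hB, hB]
  refine sampler_decisions_le p (s := s) (fun r hr => funext fun i => ?_) hε T B
  unfold losses
  split_ifs with h
  · rw [hs ⟨r, h⟩ fun h' => hr (congrArg Fin.val h')]
  · rfl

theorem expectedMistakes_expertLearner_le (p : ExpertParams I) (μ : Measure (I → X → Bool))
    [IsProbabilityMeasure μ] {T : ℕ} (S : Fin T → X × Bool) {b : ℝ≥0∞}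
    (hb : ∀ V : I → X → Bool, (∃ i, ∀ t, V i (S t).1 = (S t).2) →
      ENNReal.ofReal (phaseValue p (losses S V) T p.switches
        (switchValue p (losses S V) T p.switches) p.first 0 0) ≤ b) :
    (expertLearner p μ T).expectedMistakes S
      ≤ b + T * μ {V | ∃ i, ∀ t, V i (S t).1 = (S t).2}ᶜ := by
  have hinner : ∀ V : I → X → Bool, ∫⁻ ω, ∑ t : Fin T,
      (if (expertLearner p μ T).outputs S (V, ω) t (S t).1 ≠ (S t).2 then (1 : ℝ≥0∞) else 0)
        ∂sampler (Option I)
      ≤ b + {V | ∃ i, ∀ t, V i (S t).1 = (S t).2}ᶜ.indicator (fun _ => (T : ℝ≥0∞)) V := by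
    intro V
    by_cases hV : ∃ i, ∀ t, V i (S t).1 = (S t).2
    · refine le_trans ?_ (le_add_right (hb V hV))
      refine le_trans (le_of_eq ?_) (lintegral_mistakes_le p (losses S V) T)
      refine lintegral_congr fun ω => ?_
      rw [Finset.sum_range]
      refine Finset.sum_congr rfl fun t _ => ?_
      rw [expertLearner_outputs]
      change _ = if losses S V t (followed p S V ω t) then _ else _
      by_cases h : V (followed p S V ω t) (S t).1 = (S t).2 <;> simp [losses, h]
    · rw [Set.indicator_of_mem (by simpa using hV)]
      refine le_trans ?_ le_add_self
      calc _ ≤ ∫⁻ _, (T : ℝ≥0∞) ∂sampler (Option I) := by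
            refine lintegral_mono fun ω => ?_
            refine (Finset.sum_le_card_nsmul _ _ 1 fun t _ => ?_).trans (by simp)
            split_ifs <;> simp
        _ = T := by simp
  have hmeas : Measurable fun x : (I → X → Bool) × (ℕ × PMF (Option I) → Option I) =>
      ∑ t : Fin T, (if (expertLearner p μ T).outputs S x t (S t).1 ≠ (S t).2
        then (1 : ℝ≥0∞) else 0) := by
    refine Finset.measurable_sum _ fun t _ => Measurable.ite ?_ measurable_const measurable_const
    have h1 : Measurable fun x => (expertLearner p μ T).outputs S x t (S t).1 :=
      (measurable_pi_apply (S t).1).comp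
        ((measurable_pi_apply t).comp ((expertLearner p μ T).measurable_outputs S))
    exact (h1 (measurableSet_singleton (S t).2)).compl
  calc (expertLearner p μ T).expectedMistakes S
      = ∫⁻ V, ∫⁻ ω, ∑ t : Fin T, (if (expertLearner p μ T).outputs S (V, ω) t (S t).1 ≠ (S t).2
          then (1 : ℝ≥0∞) else 0) ∂sampler (Option I) ∂μ := lintegral_prod _ hmeas.aemeasurable
    _ ≤ ∫⁻ V, (b + {V | ∃ i, ∀ t, V i (S t).1 = (S t).2}ᶜ.indicator
          (fun _ => (T : ℝ≥0∞)) V) ∂μ := lintegral_mono hinner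
    _ = b + T * μ {V | ∃ i, ∀ t, V i (S t).1 = (S t).2}ᶜ := by
        rw [lintegral_add_left measurable_const,
          lintegral_indicator_const (measurableSet_exists_consistent S).compl]
        simp

end Learner
-- Choice of the parameters
section Tuning

variable {I : Type}

/-- Tuned parameters for the privacy budget `e ≤ 1`, with `k + 1` switches and with hazard scale
determined by `M`. -/
noncomputable def tunedParams (i : I) (e : ℝ) (he : 0 < e) (k M : ℕ) : ExpertParams I where
  first := i
  switches := k + 1
  rate := e / (4 * (k + 1))
  base := Real.exp (e / 8)
  scale := (Real.exp (e / 8) ^ M)⁻¹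
  rate_nonneg := by positivity
  one_le_base := Real.one_le_exp (by positivity)
  scale_pos := by positivity

theorem tunedParams_privacy (i : I) {e : ℝ} (he : 0 < e) (k M : ℕ) :
    (tunedParams i e he k M).base ^ 4
      * Real.exp (2 * (tunedParams i e he k M).rate) ^ (tunedParams i e he k M).switches
      = Real.exp e := by
  simp only [tunedParams]
  rw [← Real.exp_nat_mul, ← Real.exp_nat_mul, ← Real.exp_add]
  congr 1
  push_cast
  field_simp
  norm_num

theorem tunedParams_value [Fintype I] (i : I) {e L : ℝ} (he : 0 < e) (he1 : e ≤ 1) {T : ℕ}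
    (hT : 1 ≤ Real.log T) (hL : L = Real.log (Fintype.card I) + Real.log T) :
    ∃ k M : ℕ, ∀ (ℓ : ℕ → I → Bool) (i₀ : I), (∀ r < T, ℓ r i₀ = false) →
      phaseValue (tunedParams i e he k M) ℓ T (k + 1)
        (switchValue (tunedParams i e he k M) ℓ T (k + 1)) i 0 0 ≤ 313 * L ^ 2 / e := by
  have hT0 : (0 : ℝ) < T := by
    rcases Nat.eq_zero_or_pos T with h | h
    · subst h; norm_num at hT
    · exact_mod_cast h
  have hN0 : (0 : ℝ) < Fintype.card I := by exact_mod_cast Fintype.card_pos_iff.2 ⟨i⟩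
  have hlogN : 0 ≤ Real.log (Fintype.card I) := Real.log_natCast_nonneg _
  have hL1 : Real.log T ≤ L := by linarith
  -- `m` makes `rate * m ≥ 1`, hence a race factor of at most `3 / 4 ≤ exp (-1 / 4)`; `k` such
  -- factors beat the product of `T` and the number of experts. `n` makes `base ^ n ≥ T ^ 2`, which
  -- pays for premature leaving when `M = m + n`.
  obtain ⟨k, hk⟩ : ∃ k, k = ⌈4 * L⌉₊ := ⟨_, rfl⟩
  obtain ⟨m, hm⟩ : ∃ m, m = ⌈4 * ((k : ℝ) + 1) / e⌉₊ := ⟨_, rfl⟩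
  obtain ⟨n, hn⟩ : ∃ n, n = ⌈16 * Real.log T / e⌉₊ := ⟨_, rfl⟩
  have hk1 : 4 * L ≤ k := hk ▸ Nat.le_ceil _
  have hk2 : (k : ℝ) < 4 * L + 1 := hk ▸ Nat.ceil_lt_add_one (by linarith)
  have hm1 : 4 * ((k : ℝ) + 1) / e ≤ m := hm ▸ Nat.le_ceil _
  have hm2 : (m : ℝ) < 4 * ((k : ℝ) + 1) / e + 1 := hm ▸ Nat.ceil_lt_add_one (by positivity)
  have hn1 : 16 * Real.log T / e ≤ n := hn ▸ Nat.le_ceil _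
  have hn2 : (n : ℝ) < 16 * Real.log T / e + 1 := hn ▸ Nat.ceil_lt_add_one (by positivity)
  refine ⟨k, m + n, fun ℓ i₀ hreal => ?_⟩
  set p := tunedParams i e he k (m + n) with hp
  have hbase : p.base = Real.exp (e / 8) := rfl
  have hq : 1 < p.base := by rw [hbase]; exact Real.one_lt_exp_iff.2 (by positivity)
  have hM : p.scale * p.base ^ (m + n) = 1 :=
    inv_mul_cancel₀ (pow_pos (Real.exp_pos _) _).ne'
  have h := initialValue_le p (m := m) hreal (rfl : p.switches = k + 1) hq hM
  refine h.trans ?_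
  have hB : p.base / (p.base - 1) ≤ 1 + 8 / e := by
    have h1 : e / 8 ≤ p.base - 1 := by linarith [Real.add_one_le_exp (e / 8)]
    have h2 : p.base / (p.base - 1) = 1 + 1 / (p.base - 1) := by
      have : p.base - 1 ≠ 0 := by linarith
      field_simp
      ring
    rw [h2]
    have h3 : 1 / (p.base - 1) ≤ 1 / (e / 8) := one_div_le_one_div_of_le (by positivity) h1
    rw [one_div_div] at h3
    linarith
  have hθ : (1 + Real.exp (-(p.rate * m))) / 2 ≤ Real.exp (-(1 / 4)) := by
    have h1 : 1 ≤ p.rate * m := by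
      have : p.rate = e / (4 * (k + 1)) := rfl
      rw [this]
      calc (1 : ℝ) = e / (4 * (k + 1)) * (4 * ((k : ℝ) + 1) / e) := by field_simp
        _ ≤ _ := by gcongr
    have h2 : Real.exp (-(p.rate * m)) ≤ 1 / 2 := by
      have h3 : 2 ≤ Real.exp (p.rate * m) := by linarith [Real.add_one_le_exp (p.rate * m)]
      rw [Real.exp_neg, one_div]
      exact inv_anti₀ two_pos h3
    linarith [Real.add_one_le_exp (-(1 / 4) : ℝ)]
  have hterm2 : T * ((1 + Real.exp (-(p.rate * m))) / 2) ^ k * Fintype.card I ≤ 1 := by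
    calc T * ((1 + Real.exp (-(p.rate * m))) / 2) ^ k * (Fintype.card I : ℝ)
        ≤ T * Real.exp (-(1 / 4)) ^ k * Fintype.card I := by gcongr
      _ ≤ T * Real.exp (-L) * Fintype.card I := by
          rw [← Real.exp_nat_mul]
          gcongr
          linarith
      _ = 1 := by
          rw [hL, Real.exp_neg, Real.exp_add, Real.exp_log hN0, Real.exp_log hT0]
          field_simp
  have hterm3 : T * (T * (p.scale * p.base ^ m)) ≤ 1 := by
    have h1 : p.scale * p.base ^ m = Real.exp (-(n * (e / 8))) := by
      have h2 : p.scale * p.base ^ m * p.base ^ n = 1 := by rw [mul_assoc, ← pow_add, hM]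
      rw [Real.exp_neg, Real.exp_nat_mul, ← hbase]
      exact eq_inv_of_mul_eq_one_left h2
    have h3 : 2 * Real.log T ≤ n * (e / 8) := by
      calc 2 * Real.log T = 16 * Real.log T / e * (e / 8) := by field_simp; norm_num
        _ ≤ _ := by gcongr
    rw [h1]
    calc T * (T * Real.exp (-(n * (e / 8)))) ≤ T * (T * Real.exp (-(2 * Real.log T))) := by gcongr
      _ = 1 := by
          rw [two_mul, neg_add, Real.exp_add, Real.exp_neg, Real.exp_log hT0]
          field_simp
  have hK : (k : ℝ) + 1 ≤ 6 * L := by linarith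
  have hBtot : ((m + n : ℕ) : ℝ) + p.base / (p.base - 1) ≤ 51 * L / e := by
    have h1 : 4 * ((k : ℝ) + 1) / e ≤ 24 * L / e :=
      div_le_div_of_nonneg_right (by linarith) he.le
    have h2 : 16 * Real.log T / e ≤ 16 * L / e := by gcongr
    have h3 : (3 : ℝ) ≤ 3 * L / e := by
      rw [le_div_iff₀ he]; nlinarith
    have h4 : 8 / e ≤ 8 * L / e := by
      gcongr
      linarith
    have h5 : 51 * L / e = 24 * L / e + 16 * L / e + 3 * L / e + 8 * L / e := by ring
    push_cast
    linarith
  have hk3 : (k : ℝ) * (T * (T * (p.scale * p.base ^ m))) ≤ 6 * L - 1 :=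
    (mul_le_of_le_one_right (Nat.cast_nonneg _) hterm3).trans (by linarith)
  have h6 : ((k : ℝ) + 1) * (((m + n : ℕ) : ℝ) + p.base / (p.base - 1))
      ≤ 6 * L * (51 * L / e) := by
    refine mul_le_mul hK hBtot ?_ (by linarith)
    have : 0 < p.base - 1 := by linarith
    have : 0 < p.base := by linarith
    positivity
  have h7 : 7 * L ≤ 7 * L ^ 2 / e := by
    rw [le_div_iff₀ he]; nlinarith
  have h8 : 313 * L ^ 2 / e = 6 * L * (51 * L / e) + 7 * L ^ 2 / e := by ring
  rw [h8]
  linarith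

/-- A random list of experts, containing a consistent expert with probability `1 - 1 / T`, yields a
private online learner. -/
theorem exists_learner_of_experts {X : Type u} [Fintype I] [Nonempty I]
    (μ : Measure (I → X → Bool)) [IsProbabilityMeasure μ] {T : ℕ} (hT : 1 ≤ Real.log T) {ε : ℝ}
    (hε : 0 < ε) :
    ∃ A : OnlineLearner X T, IsPureDP ε A.law ∧ ∀ S : Fin T → X × Bool,
      T * μ {V | ∃ i, ∀ t, V i (S t).1 = (S t).2}ᶜ ≤ 1 →
        A.expectedMistakes S ≤ ENNReal.ofReal
          (314 * (Real.log (Fintype.card I) + Real.log T) ^ 2 / min ε 1) := by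
  let _ : MeasurableSpace (Option I) := ⊤
  have : MeasurableSingletonClass (Option I) := ⟨fun _ => trivial⟩
  obtain ⟨i⟩ := ‹Nonempty I›
  have he : 0 < min ε 1 := lt_min hε one_pos
  set L := Real.log (Fintype.card I) + Real.log T with hL
  obtain ⟨k, M, hval⟩ := tunedParams_value i he (min_le_right ε 1) hT hL
  refine ⟨expertLearner (tunedParams i (min ε 1) he k M) μ T, isPureDP_expertLearner _ μ T ?_,
    fun S hS => ?_⟩
  · rw [tunedParams_privacy]
    exact Real.exp_le_exp.2 (min_le_left _ _)
  · have hL1 : 1 ≤ L := by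
      have : 0 ≤ Real.log (Fintype.card I) := Real.log_natCast_nonneg _
      linarith
    have h1 : 1 ≤ L ^ 2 / min ε 1 := by
      rw [le_div_iff₀ he]
      nlinarith [min_le_right ε 1]
    refine (expectedMistakes_expertLearner_le _ μ S
      (b := ENNReal.ofReal (313 * L ^ 2 / min ε 1)) fun V hV => ?_).trans ?_
    · obtain ⟨i₀, hi₀⟩ := hV
      refine ENNReal.ofReal_le_ofReal (hval _ i₀ fun r hr => ?_)
      simp [losses, hr, hi₀ ⟨r, hr⟩]
    -- The extra one pays for lists without a consistent expert, on which all `T` rounds may be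
    -- mistakes.
    · calc _ ≤ ENNReal.ofReal (313 * L ^ 2 / min ε 1) + ENNReal.ofReal 1 := by
            rw [ENNReal.ofReal_one]; gcongr
        _ = ENNReal.ofReal (313 * L ^ 2 / min ε 1 + 1) :=
            (ENNReal.ofReal_add (by positivity) zero_le_one).symm
        _ ≤ _ := by
            refine ENNReal.ofReal_le_ofReal ?_
            have : 314 * L ^ 2 / min ε 1 = 313 * L ^ 2 / min ε 1 + L ^ 2 / min ε 1 := by ring
            linarith

end Tuning
/-! ### Boosting a probabilistic representation -/

section Boosting

variable {X : Type u}

theorem measurable_of_sigma {ι : Type*} {β : ι → Type*} [∀ i, MeasurableSpace (β i)] {γ : Type*}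
    [MeasurableSpace γ] {f : Sigma β → γ} (h : ∀ i, Measurable fun b => f ⟨i, b⟩) :
    Measurable f := fun _ hs => MeasurableSpace.measurableSet_iInf.2 fun i => h i hs

/-- Pad or truncate a listed class to a list of length `N`. -/
def padClass (N : ℕ) (V : FiniteClass X) (i : Fin N) : X → Bool :=
  if h : i < V.1 then V.2 ⟨i, h⟩ else fun _ => false

theorem measurable_padClass (N : ℕ) : Measurable (padClass (X := X) N) := by
  refine measurable_of_sigma (β := fun k => Fin k → X → Bool) fun k => measurable_pi_lambda _ fun i => ?_
  unfold padClass
  by_cases h : (i : ℕ) < k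
  · simp only [h, dite_true]
    exact (measurable_pi_apply (⟨i, h⟩ : Fin k) :
      Measurable fun v : Fin k → X → Bool => v ⟨i, h⟩)
  · simp only [h, dite_false]
    exact measurable_const

theorem card_le_of_size_lt {P : Measure (FiniteClass X)} {s : ℝ}
    (h : size P < ENNReal.ofReal s) : ∀ᵐ V ∂P, V.1 ≤ ⌊Real.exp s⌋₊ := by
  filter_upwards [ENNReal.ae_le_essSup (μ := P)
    fun V : FiniteClass X => ENNReal.ofReal (Real.log V.1)] with V hV
  have h1 := hV.trans_lt h
  -- Since `Real.log 0 = 0`, the empty class needs its own case.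
  rcases Nat.eq_zero_or_pos V.1 with h0 | h0
  · rw [h0]; exact Nat.zero_le _
  · have h2 : Real.log V.1 < s := (ENNReal.ofReal_lt_ofReal_iff'.1 h1).1
    exact Nat.le_floor ((Real.log_lt_iff_lt_exp (by exact_mod_cast h0)).1 h2).le

/-- The total weight `u` of the examples that `v` gets wrong. -/
noncomputable def wrongWt {T : ℕ} (S : Fin T → X × Bool) (u : Fin T → ℝ) (v : X → Bool) : ℝ :=
  ∑ t, if v (S t).1 = (S t).2 then 0 else u t

theorem measurable_wrongWt {T : ℕ} (S : Fin T → X × Bool) (u : Fin T → ℝ) :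
    Measurable (wrongWt S u) :=
  Finset.measurable_sum _ fun t _ => Measurable.ite
    ((measurable_pi_apply (S t).1) (measurableSet_singleton _)) measurable_const measurable_const

/-- One of the hypotheses `V` has error at most `1/4` under the weights `u`. -/
def HasWeakHyp {J : Type} {T : ℕ} (S : Fin T → X × Bool) (u : Fin T → ℝ) (V : J → X → Bool) :
    Prop := ∃ i, wrongWt S u (V i) ≤ 1 / 4 * ∑ t, u t

theorem measurableSet_hasWeakHyp {J : Type} [Countable J] {T : ℕ} (S : Fin T → X × Bool)
    (u : Fin T → ℝ) : MeasurableSet {V : J → X → Bool | HasWeakHyp S u V} := by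
  have : {V : J → X → Bool | HasWeakHyp S u V}
      = ⋃ i, {V : J → X → Bool | wrongWt S u (V i) ≤ 1 / 4 * ∑ t, u t} := by
    ext V; simp [HasWeakHyp]
  rw [this]
  exact MeasurableSet.iUnion fun i => measurableSet_le
    ((measurable_wrongWt S u).comp (measurable_pi_apply i)) measurable_const

/-- Pushing normalized weights forward along the stream turns weighted training error into
distributional error, so the representation can serve as a weak learner. -/
theorem exists_weighted_distribution {T : ℕ} {h : X → Bool} {S : Fin T → X × Bool}
    (hS : ∀ t, (S t).2 = h (S t).1) {u : Fin T → ℝ} (hu : ∀ t, 0 < u t) (hT : 0 < T) :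
    ∃ D : PMF (X × Bool), LabelledBy D h ∧
      ∀ v, err D v = ENNReal.ofReal (wrongWt S u v / ∑ t, u t) := by
  have hU : 0 < ∑ t, u t := Finset.sum_pos (fun t _ => hu t) ⟨⟨0, hT⟩, Finset.mem_univ _⟩
  have h0 : ∀ t, 0 ≤ u t / ∑ t, u t := fun t => div_nonneg (hu t).le hU.le
  let q : PMF (Fin T) := PMF.ofFintype (fun t => ENNReal.ofReal (u t / ∑ t, u t)) (by
    rw [← ENNReal.ofReal_sum_of_nonneg fun t _ => h0 t, ← Finset.sum_div, div_self hU.ne',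
      ENNReal.ofReal_one])
  refine ⟨q.map S, fun z hz => ?_, fun v => ?_⟩
  · obtain ⟨t, -, rfl⟩ := (PMF.mem_support_map_iff _ _ _).1 hz
    exact hS t
  · rw [err, PMF.toOuterMeasure_map_apply, PMF.toOuterMeasure_apply_fintype, wrongWt,
      Finset.sum_div, ENNReal.ofReal_sum_of_nonneg]
    · refine Finset.sum_congr rfl fun t _ => ?_
      by_cases hv : v (S t).1 = (S t).2
      · rw [Set.indicator_of_notMem (by simpa using hv)]; simp [hv]
      · rw [Set.indicator_of_mem (by simpa using hv)]; simp [hv, q]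
    · intro t _
      split_ifs
      · simp
      · exact h0 t

/-- A representation of small size gives a random list of bounded length that contains a weak
hypothesis for all weighted realizable samples. -/
theorem exists_weak_list {H : Set (X → Bool)} {P : Measure (FiniteClass X)}
    (hP : IsProbRep H (1 / 4) (1 / 4) P) {s : ℝ} (hs : size P < ENNReal.ofReal s) :
    ∃ μ : Measure (Fin ⌊Real.exp s⌋₊ → X → Bool), IsProbabilityMeasure μ ∧
      ∀ (T : ℕ) (S : Fin T → X × Bool), Realizable H S → 0 < T → ∀ u : Fin T → ℝ, (∀ t, 0 < u t) →
        μ {V | HasWeakHyp S u V}ᶜ ≤ 1 / 4 := by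
  obtain ⟨hprob, hrep⟩ := hP
  have hpad := measurable_padClass (X := X) ⌊Real.exp s⌋₊
  have hμ := Measure.isProbabilityMeasure_map (μ := P) hpad.aemeasurable
  refine ⟨P.map (padClass ⌊Real.exp s⌋₊), hμ, ?_⟩
  rintro T S ⟨h, hh, hS⟩ hT u hu
  obtain ⟨D, hD, herr⟩ := exists_weighted_distribution hS hu hT
  have hU : 0 < ∑ t, u t := Finset.sum_pos (fun t _ => hu t) ⟨⟨0, hT⟩, Finset.mem_univ _⟩
  have h1 : 1 - 1 / 4 ≤ P.map (padClass ⌊Real.exp s⌋₊) {V | HasWeakHyp S u V} := by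
    refine (hrep h hh D hD).trans (le_trans (measure_mono_ae ?_)
      (Measure.le_map_apply hpad.aemeasurable _))
    filter_upwards [card_le_of_size_lt hs] with V hV
    rintro ⟨i, hi⟩
    refine ⟨⟨i, i.isLt.trans_le hV⟩, ?_⟩
    have hpi : padClass ⌊Real.exp s⌋₊ V ⟨i, i.isLt.trans_le hV⟩ = V.2 i := by
      simp [padClass]
    rw [hpi]
    rw [herr, show (1 / 4 : ℝ≥0∞) = ENNReal.ofReal (1 / 4) by
      rw [ENNReal.ofReal_div_of_pos (by norm_num)]; simp, ENNReal.ofReal_le_ofReal_iff (by norm_num),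
      div_le_iff₀ hU] at hi
    exact hi
  rw [prob_compl_eq_one_sub (measurableSet_hasWeakHyp S u)]
  refine (tsub_le_tsub_left h1 1).trans ?_
  rw [ENNReal.sub_sub_cancel ENNReal.one_ne_top]
  exact ENNReal.div_le_of_le_mul (by norm_num)

/-- The union of `m` independent lists. -/
theorem exists_amplified_list {J : Type} [Countable J] (μ : Measure (J → X → Bool))
    [IsProbabilityMeasure μ] (m : ℕ) :
    ∃ ν : Measure (Fin m × J → X → Bool), IsProbabilityMeasure ν ∧
      ∀ (T : ℕ) (S : Fin T → X × Bool) (u : Fin T → ℝ),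
        ν {V | HasWeakHyp S u V}ᶜ = (μ {V | HasWeakHyp S u V}ᶜ) ^ m := by
  have hm : Measurable fun (W : Fin m → J → X → Bool) (i : Fin m × J) => W i.1 i.2 :=
    measurable_pi_lambda _ fun i => (measurable_pi_apply i.2).comp (measurable_pi_apply i.1)
  refine ⟨(Measure.pi fun _ : Fin m => μ).map fun W i => W i.1 i.2,
    Measure.isProbabilityMeasure_map hm.aemeasurable, fun T S u => ?_⟩
  rw [Measure.map_apply hm (measurableSet_hasWeakHyp S u).compl]
  have : (fun (W : Fin m → J → X → Bool) (i : Fin m × J) => W i.1 i.2) ⁻¹'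
      {V | HasWeakHyp S u V}ᶜ = Set.univ.pi fun _ => {V | HasWeakHyp S u V}ᶜ := by
    ext W
    simp [HasWeakHyp]
  rw [this, Measure.pi_pi, Finset.prod_const, Finset.card_fin]

/-- The factor by which boosting changes the weight of example `z` after choosing `v`. -/
noncomputable def boostFactor (z : X × Bool) (v : X → Bool) : ℝ :=
  if v z.1 = z.2 then 1 / 4 else 1

theorem boostFactor_pos (z : X × Bool) (v : X → Bool) : 0 < boostFactor z v := by
  unfold boostFactor; split_ifs <;> norm_num

theorem measurable_boostFactor (z : X × Bool) : Measurable (boostFactor z) :=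
  Measurable.ite ((measurable_pi_apply z.1) (measurableSet_singleton _))
    measurable_const measurable_const

/-- No choice of one hypothesis from each list makes boosting succeed. -/
def boostFails {J : Type} {T r : ℕ} (S : Fin T → X × Bool) (u : Fin T → ℝ) :
    Set (Fin r → J → X → Bool) :=
  {W | ∀ f : Fin r → J,
    (7 / 16) ^ r * ∑ t, u t < ∑ t, u t * ∏ j, boostFactor (S t) (W j (f j))}

theorem measurableSet_boostFails {J : Type} [Finite J] {T r : ℕ} (S : Fin T → X × Bool)
    (u : Fin T → ℝ) : MeasurableSet (boostFails (J := J) (r := r) S u) := by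
  have : boostFails (J := J) (r := r) S u = ⋂ f : Fin r → J, {W : Fin r → J → X → Bool |
      (7 / 16) ^ r * ∑ t, u t < ∑ t, u t * ∏ j, boostFactor (S t) (W j (f j))} := by
    ext W; simp [boostFails]
  rw [this]
  refine MeasurableSet.iInter fun f => measurableSet_lt measurable_const ?_
  refine Finset.measurable_sum _ fun t _ => Measurable.const_mul ?_ _
  refine Finset.measurable_prod _ fun j _ => ?_
  exact (measurable_boostFactor (S t)).comp
    ((measurable_pi_apply (f j)).comp (measurable_pi_apply j))

theorem sum_mul_boostFactor_le {T : ℕ} {S : Fin T → X × Bool} {u : Fin T → ℝ} {v : X → Bool}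
    (h : wrongWt S u v ≤ 1 / 4 * ∑ t, u t) :
    ∑ t, u t * boostFactor (S t) v ≤ 7 / 16 * ∑ t, u t := by
  -- With weighted error at most `1 / 4` this gives `1 / 4 + 3 / 16 = 7 / 16`.
  have : ∑ t, u t * boostFactor (S t) v = 1 / 4 * ∑ t, u t + 3 / 4 * wrongWt S u v := by
    rw [wrongWt, Finset.mul_sum, Finset.mul_sum, ← Finset.sum_add_distrib]
    refine Finset.sum_congr rfl fun t _ => ?_
    unfold boostFactor
    split_ifs <;> ring
  linarith

theorem boostFails_cons {J : Type} {T r : ℕ} {S : Fin T → X × Bool} {u : Fin T → ℝ}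
    {V : J → X → Bool} {W : Fin r → J → X → Bool} {i : J}
    (hi : wrongWt S u (V i) ≤ 1 / 4 * ∑ t, u t)
    (h : (Fin.cons V W : Fin (r + 1) → J → X → Bool) ∈ boostFails S u) :
    W ∈ boostFails S fun t => u t * boostFactor (S t) (V i) := by
  intro f
  have h1 := h (Fin.cons i f)
  simp only [Fin.prod_univ_succ, Fin.cons_zero, Fin.cons_succ] at h1
  have h2 := sum_mul_boostFactor_le hi
  calc (7 / 16) ^ r * ∑ t, u t * boostFactor (S t) (V i)
      ≤ (7 / 16) ^ r * (7 / 16 * ∑ t, u t) := by gcongr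
    _ = (7 / 16) ^ (r + 1) * ∑ t, u t := by ring
    _ < _ := h1
    _ = _ := Finset.sum_congr rfl fun t _ => by ring

/-- Condition on the first list. Either it lacks a weak hypothesis, or the independent remaining
lists must fail for the updated weights. Since failure quantifies over all selections, the weak
hypothesis can be picked separately for each list, with no measurable selection. -/
theorem measure_boostFails_le {J : Type} [Finite J] {T : ℕ} {S : Fin T → X × Bool}
    (ν : Measure (J → X → Bool)) [IsProbabilityMeasure ν] {β : ℝ≥0∞}
    (hν : ∀ u : Fin T → ℝ, (∀ t, 0 < u t) → ν {V | HasWeakHyp S u V}ᶜ ≤ β) (r : ℕ)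
    {u : Fin T → ℝ} (hu : ∀ t, 0 < u t) :
    Measure.pi (fun _ : Fin r => ν) (boostFails S u) ≤ r * β := by
  induction r generalizing u with
  | zero =>
    have : boostFails (J := J) (r := 0) S u = ∅ := by
      ext W; simp [boostFails]
    simp [this]
  | succ r ih =>
    have hmp := (measurePreserving_piFinSuccAbove (fun _ : Fin (r + 1) => ν) 0).symm
    rw [← hmp.measure_preimage_equiv, Measure.prod_apply
      (hmp.measurable (measurableSet_boostFails S u))]
    calc _ ≤ ∫⁻ V, ({V | HasWeakHyp S u V}ᶜ.indicator 1 V + r * β) ∂ν := by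
          refine lintegral_mono fun V => ?_
          by_cases hV : HasWeakHyp S u V
          · refine le_trans ?_ le_add_self
            obtain ⟨i, hi⟩ := hV
            refine (measure_mono fun W hW => ?_).trans
              (ih (u := fun t => u t * boostFactor (S t) (V i))
                fun t => mul_pos (hu t) (boostFactor_pos _ _))
            refine boostFails_cons hi ?_
            simpa [MeasurableEquiv.piFinSuccAbove, Fin.consEquiv] using hW
          · rw [Set.indicator_of_mem (by simpa using hV)]
            refine le_trans ?_ le_self_add
            exact prob_le_one
      _ ≤ β + r * β := by
          rw [lintegral_add_right _ measurable_const,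
            lintegral_indicator_one (measurableSet_hasWeakHyp S u).compl, lintegral_const,
            measure_univ, mul_one]
          gcongr
          exact hν u hu
      _ = _ := by push_cast; ring

/-- The majority vote. -/
def majority {r : ℕ} (v : Fin r → X → Bool) (x : X) : Bool :=
  decide (r < 2 * (Finset.univ.filter fun j => v j x = true).card)

theorem two_mul_card_correct_le {r : ℕ} {v : Fin r → X → Bool} {z : X × Bool}
    (h : majority v z.1 ≠ z.2) : 2 * (Finset.univ.filter fun j => v j z.1 = z.2).card ≤ r := by
  obtain ⟨x, y⟩ := z
  have h1 := Finset.card_filter_add_card_filter_not (s := (Finset.univ : Finset (Fin r)))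
    (fun j => v j x = true)
  rw [Finset.card_univ, Fintype.card_fin] at h1
  cases y
  · have h2 : (Finset.univ.filter fun j => v j x = false)
        = Finset.univ.filter fun j => ¬ v j x = true := by
      ext j; simp
    simp only [majority] at h ⊢
    rw [h2]
    simp at h
    simp only [Bool.not_eq_true] at h1 ⊢
    lia
  · simp only [majority] at h ⊢
    simp at h
    lia

theorem prod_boostFactor {r : ℕ} (v : Fin r → X → Bool) (z : X × Bool) :
    ∏ j, boostFactor z (v j) = (1 / 4) ^ (Finset.univ.filter fun j => v j z.1 = z.2).card := by
  unfold boostFactor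
  rw [Finset.prod_ite, Finset.prod_const_one, mul_one, Finset.prod_const]

/-- An example lost by the majority was discounted at most `r / 2` times, so it keeps weight at
least `(1 / 2) ^ r`; but the total is below `(7 / 16 * 8 / 7) ^ r = (1 / 2) ^ r`. -/
theorem majority_consistent {T r : ℕ} {S : Fin T → X × Bool} {v : Fin r → X → Bool}
    (h : ∑ t, ∏ j, boostFactor (S t) (v j) ≤ (7 / 16) ^ r * T)
    (hr : (T : ℝ) < (8 / 7) ^ r) (t : Fin T) : majority v (S t).1 = (S t).2 := by
  by_contra hne
  have h1 := two_mul_card_correct_le hne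
  have h2 : (1 / 2 : ℝ) ^ r ≤ ∏ j, boostFactor (S t) (v j) := by
    rw [prod_boostFactor, show (1 / 4 : ℝ) = (1 / 2) ^ 2 by norm_num, ← pow_mul]
    exact pow_le_pow_of_le_one (by norm_num) (by norm_num) h1
  have h3 : ∏ j, boostFactor (S t) (v j) ≤ ∑ t, ∏ j, boostFactor (S t) (v j) :=
    Finset.single_le_sum (f := fun t => ∏ j, boostFactor (S t) (v j))
      (fun t _ => Finset.prod_nonneg fun j _ => (boostFactor_pos _ _).le) (Finset.mem_univ t)
  have h4 : (7 / 16 : ℝ) ^ r * T < (7 / 16) ^ r * (8 / 7) ^ r := by gcongr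
  rw [← mul_pow] at h4
  norm_num at h2 h4
  linarith

theorem measurable_majority (r : ℕ) :
    Measurable fun v : Fin r → X → Bool => majority v := by
  refine measurable_pi_lambda _ fun x => ?_
  have h1 : Measurable fun (v : Fin r → X → Bool) (j : Fin r) => v j x :=
    measurable_pi_lambda _ fun j => (measurable_pi_apply x).comp (measurable_pi_apply j)
  have h2 : Measurable fun b : Fin r → Bool =>
      decide (r < 2 * (Finset.univ.filter fun j => b j = true).card) := measurable_of_finite _
  have h3 := h2.comp h1
  simp only [Function.comp_def] at h3
  exact h3

/-- The majority votes over one hypothesis from each list. -/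
def majorityVotes {J : Type} {r : ℕ} (W : Fin r → J → X → Bool) (f : Fin r → J) : X → Bool :=
  majority fun j => W j (f j)

theorem measurable_majorityVotes (J : Type) (r : ℕ) :
    Measurable (majorityVotes (X := X) (J := J) (r := r)) := by
  refine measurable_pi_lambda _ fun f => ?_
  have h1 : Measurable fun (W : Fin r → J → X → Bool) (j : Fin r) => W j (f j) :=
    measurable_pi_lambda _ fun j => (measurable_pi_apply (f j)).comp (measurable_pi_apply j)
  exact (measurable_majority r).comp h1

theorem exists_majorityVotes_consistent {J : Type} {T r : ℕ} {S : Fin T → X × Bool}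
    {W : Fin r → J → X → Bool} (hr : (T : ℝ) < (8 / 7) ^ r) (h : W ∉ boostFails S fun _ => 1) :
    ∃ f, ∀ t, majorityVotes W f (S t).1 = (S t).2 := by
  simp only [boostFails, Set.mem_ofPred_eq, not_forall, not_lt] at h
  obtain ⟨f, hf⟩ := h
  exact ⟨f, majority_consistent (v := fun j => W j (f j)) (by simpa using hf) hr⟩

/-- Majority votes over one hypothesis from each of `r` independent lists contain, with high
probability, a consistent hypothesis. -/
theorem measure_majorityVotes_le {J : Type} [Finite J] (ν : Measure (J → X → Bool))
    [IsProbabilityMeasure ν] {T r : ℕ} {S : Fin T → X × Bool} {β : ℝ≥0∞}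
    (hr : (T : ℝ) < (8 / 7) ^ r)
    (hν : ∀ u : Fin T → ℝ, (∀ t, 0 < u t) → ν {V | HasWeakHyp S u V}ᶜ ≤ β) :
    (Measure.pi fun _ : Fin r => ν).map majorityVotes
      {V | ∃ i, ∀ t, V i (S t).1 = (S t).2}ᶜ ≤ r * β := by
  have := Fintype.ofFinite J
  rw [Measure.map_apply (measurable_majorityVotes J r) (measurableSet_exists_consistent S).compl]
  refine (measure_mono fun W hW => ?_).trans
    (measure_boostFails_le ν hν r (u := fun _ => 1) fun _ => one_pos)
  by_contra hf
  exact hW (exists_majorityVotes_consistent hr hf)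

end Boosting
/-! ### Private PAC learnability bounds the representation dimension -/

section PAC

variable {X : Type u}

/-- A discrete distribution has countable support, so the error is a countable sum of functions of
single evaluations, even for uncountable `X`. -/
theorem measurable_err (D : PMF (X × Bool)) : Measurable (err D) := by
  have h : ∀ v : X → Bool, err D v
      = ∑' z : D.support, if v z.1.1 = z.1.2 then 0 else D z := fun v => by
    rw [err, PMF.toOuterMeasure_apply, ← tsum_subtype_eq_of_support_subset (s := D.support)]
    · refine tsum_congr fun z => ?_
      by_cases hz : v z.1.1 = z.1.2 <;> simp [Set.indicator, hz]
    · intro z hz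
      exact (Set.indicator_apply_ne_zero.1 hz).2
  have := D.support_countable.to_subtype
  rw [funext h]
  exact Measurable.tsum fun z => Measurable.ite
    ((measurable_pi_apply z.1.1) (measurableSet_singleton _)) measurable_const measurable_const

/-- Replace the entries of `S` by those of `S₀` one at a time. -/
theorem group_privacy {Z R : Type*} [MeasurableSpace R] {n : ℕ} {ε : ℝ}
    {A : (Fin n → Z) → Measure R} (hA : IsPureDP ε A) (S S₀ : Fin n → Z) {O : Set R}
    (hO : MeasurableSet O) : A S O ≤ ENNReal.ofReal (Real.exp ε) ^ n * A S₀ O := by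
  have key : ∀ j ≤ n, A S O ≤ ENNReal.ofReal (Real.exp ε) ^ j
      * A (fun i => if (i : ℕ) < j then S₀ i else S i) O := by
    intro j hj
    induction j with
    | zero => simp
    | succ j ih =>
      refine (ih (by lia)).trans ?_
      rw [pow_succ, mul_assoc]
      gcongr
      refine hA _ _ ⟨⟨j, hj⟩, fun i hi => ?_⟩ O hO
      have : (i : ℕ) ≠ j := fun h => hi (Fin.ext h)
      by_cases h : (i : ℕ) < j
      · simp [h, h.trans (Nat.lt_succ_self j)]
      · simp [h, show ¬ (i : ℕ) < j + 1 by lia]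
  simpa using key n le_rfl

theorem tsum_prod_pmf {Z : Type*} (D : PMF Z) (n : ℕ) :
    ∑' S : Fin n → Z, ∏ i, D (S i) = 1 := by
  induction n with
  | zero => simp
  | succ n ih =>
    rw [← (Fin.consEquiv fun _ : Fin (n + 1) => Z).tsum_eq]
    simp only [Fin.prod_univ_succ, Fin.consEquiv_apply, Fin.cons_zero, Fin.cons_succ]
    rw [ENNReal.tsum_prod (f := fun z (S : Fin n → Z) => D z * ∏ i, D (S i))]
    simp_rw [ENNReal.tsum_mul_left, ih, mul_one]
    exact D.tsum_coe

/-- A list of `m` hypotheses as a finite class. -/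
def listedClass (m : ℕ) (v : Fin m → X → Bool) : FiniteClass X := ⟨m, v⟩

theorem measurable_listedClass (m : ℕ) : Measurable (listedClass (X := X) m) := fun _ hs =>
  MeasurableSpace.measurableSet_iInf.1 hs m

theorem size_map_lt_top {m : ℕ} (ν : Measure (Fin m → X → Bool)) :
    size (ν.map (listedClass m)) < ⊤ := by
  have hmk := measurable_listedClass (X := X) m
  have hlog : Measurable fun V : FiniteClass X => ENNReal.ofReal (Real.log V.1) :=
    measurable_of_sigma (β := fun k => Fin k → X → Bool) fun k =>
      (measurable_const : Measurable fun _ : Fin k → X → Bool => ENNReal.ofReal (Real.log k))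
  rw [size, essSup_map_measure_of_measurable hlog hmk.aemeasurable]
  exact (essSup_le_of_ae_le (ENNReal.ofReal (Real.log m))
    (Filter.Eventually.of_forall fun _ => le_rfl)).trans_lt ENNReal.ofReal_lt_top

/-- Independent copies of a random hypothesis that is good with probability at least `g` form a
probabilistic representation. -/
theorem repDim_lt_top_of_hypothesis {H : Set (X → Bool)} (ρ : Measure (X → Bool))
    [IsProbabilityMeasure ρ] {g : ℝ≥0∞} (hg : g ≠ 0)
    (h : ∀ h ∈ H, ∀ D : PMF (X × Bool), LabelledBy D h → g ≤ ρ {v | err D v ≤ 1 / 4}) :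
    repDim H < ⊤ := by
  obtain ⟨m, hm⟩ : ∃ m : ℕ, (1 - g) ^ m ≤ 1 / 4 := by
    have h1 : 1 - g < 1 := ENNReal.sub_lt_self ENNReal.one_ne_top one_ne_zero hg
    have h2 := ENNReal.tendsto_pow_atTop_nhds_zero_of_lt_one h1
    exact (h2.eventually (ge_mem_nhds (by simp : (0 : ℝ≥0∞) < 1 / 4))).exists
  have hmk := measurable_listedClass (X := X) m
  let ν : Measure (Fin m → X → Bool) := Measure.pi fun _ => ρ
  refine lt_of_le_of_lt (iInf₂_le (ν.map (listedClass m)) ?_) (size_map_lt_top ν)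
  refine ⟨Measure.isProbabilityMeasure_map hmk.aemeasurable, fun c hc D hD => ?_⟩
  refine le_trans ?_ (Measure.le_map_apply hmk.aemeasurable _)
  have hmeas : MeasurableSet {v | err D v ≤ 1 / 4} :=
    measurableSet_le (measurable_err D) measurable_const
  have hset : (listedClass m) ⁻¹' {V | ∃ i, err D (V.2 i) ≤ 1 / 4}
      = (Set.univ.pi fun _ : Fin m => {v | err D v ≤ 1 / 4}ᶜ)ᶜ := by
    ext v; simp [listedClass]
  rw [hset, prob_compl_eq_one_sub (MeasurableSet.univ_pi fun _ => hmeas.compl), Measure.pi_pi,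
    Finset.prod_const, Finset.card_fin, prob_compl_eq_one_sub hmeas]
  refine tsub_le_tsub_left (le_trans ?_ hm) 1
  gcongr
  exact h c hc D hD

/-- Averaging group privacy over the sample shows that the output law on one fixed dataset succeeds
with probability at least `(1 / 2) / exp (ε * n)`, simultaneously for all targets and distributions.
-/
theorem repDim_lt_top {H : Set (X → Bool)} {ε : ℝ} (h : PACLearnableDP ε H) : repDim H < ⊤ := by
  -- A reference dataset needs a point of `X`; over an empty `X` there are no example distributions.
  rcases isEmpty_or_nonempty X with hX | ⟨⟨x⟩⟩
  · refine repDim_lt_top_of_hypothesis (Measure.dirac fun _ => false) one_ne_zero fun _ _ D => ?_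
    obtain ⟨z, -⟩ := D.support_nonempty
    exact (hX.false z.1).elim
  · obtain ⟨n, A, hprob, hdp, hpac⟩ := h (1 / 4) (1 / 2) (by simp)
      (ENNReal.div_lt_of_lt_mul (by norm_num)) (by simp) (ENNReal.div_lt_of_lt_mul (by norm_num))
    let S₀ : Fin n → X × Bool := fun _ => (x, false)
    have hc0 : ENNReal.ofReal (Real.exp ε) ^ n ≠ 0 :=
      pow_ne_zero _ (ENNReal.ofReal_pos.2 (Real.exp_pos ε)).ne'
    have hc : ENNReal.ofReal (Real.exp ε) ^ n ≠ ⊤ := ENNReal.pow_ne_top ENNReal.ofReal_ne_top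
    have := hprob S₀
    refine repDim_lt_top_of_hypothesis (A S₀)
      (g := (1 - 1 / 2) / ENNReal.ofReal (Real.exp ε) ^ n) ?_ fun c hcH D hD => ?_
    · refine (ENNReal.div_pos ?_ hc).ne'
      exact (tsub_pos_of_lt (ENNReal.div_lt_of_lt_mul (by norm_num))).ne'
    · refine ENNReal.div_le_of_le_mul' ((hpac c hcH D hD).trans ?_)
      have hmeas : MeasurableSet {v | err D v ≤ 1 / 4} :=
        measurableSet_le (measurable_err D) measurable_const
      calc _ ≤ ∑' S : Fin n → X × Bool, (∏ i, D (S i))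
            * (ENNReal.ofReal (Real.exp ε) ^ n * A S₀ {v | err D v ≤ 1 / 4}) := by
            gcongr with S
            exact group_privacy hdp S S₀ hmeas
        _ = _ := by rw [ENNReal.tsum_mul_right, tsum_prod_pmf, one_mul]

end PAC
-- Assembly of the quantitative bound and its consequence
section Final

variable {X : Type u}

theorem one_lt_log {T : ℕ} (hT : 3 ≤ T) : 1 < Real.log T := by
  rw [Real.lt_log_iff_exp_lt (by positivity)]
  have : (3 : ℝ) ≤ T := by exact_mod_cast hT
  linarith [Real.exp_one_lt_d9]

theorem loglog_three_pos : 0 < Real.log (Real.log 3) :=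
  Real.log_pos (by exact_mod_cast one_lt_log le_rfl)

theorem loglog_three_le {T : ℕ} (hT : 3 ≤ T) : Real.log (Real.log 3) ≤ Real.log (Real.log T) := by
  have h3 : (0 : ℝ) < Real.log 3 := Real.log_pos (by norm_num)
  gcongr
  exact_mod_cast hT

theorem boosting_rounds {T r : ℕ} (hT : 3 ≤ T) (hr : r = ⌈8 * Real.log T⌉₊ + 1) :
    (T : ℝ) < (8 / 7) ^ r ∧ (r : ℝ) ≤ 10 * Real.log T := by
  have h1 := one_lt_log hT
  have h2 : 8 * Real.log T ≤ ⌈8 * Real.log T⌉₊ := Nat.le_ceil _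
  have h3 : (⌈8 * Real.log T⌉₊ : ℝ) < 8 * Real.log T + 1 := Nat.ceil_lt_add_one (by linarith)
  have hr' : (r : ℝ) = ⌈8 * Real.log T⌉₊ + 1 := by rw [hr]; push_cast; ring
  refine ⟨?_, by linarith⟩
  rw [← Real.log_lt_log_iff (by positivity) (by positivity), Real.log_pow]
  have h4 : (1 / 8 : ℝ) ≤ Real.log (8 / 7) := by
    have := Real.one_sub_inv_le_log_of_pos (by norm_num : (0 : ℝ) < 8 / 7)
    norm_num at this ⊢
    linarith
  have h5 : (r : ℝ) * (1 / 8) ≤ r * Real.log (8 / 7) := by gcongr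
  linarith

theorem horizon_mul_failure_le {T r : ℕ} (hr : (T : ℝ) < (8 / 7) ^ r) :
    (T : ℝ≥0∞) * (r * (1 / 4) ^ r) ≤ 1 := by
  have h1 : T ≤ 2 ^ r := by
    have : (T : ℝ) ≤ 2 ^ r := hr.le.trans (pow_le_pow_left₀ (by norm_num) (by norm_num) r)
    exact_mod_cast this
  have h2 : T * r ≤ 4 ^ r := by
    calc T * r ≤ 2 ^ r * 2 ^ r := Nat.mul_le_mul h1 (Nat.lt_two_pow_self).le
      _ = 4 ^ r := by rw [← mul_pow]; norm_num
  calc (T : ℝ≥0∞) * (r * (1 / 4) ^ r) = ((T * r : ℕ) : ℝ≥0∞) * (1 / 4) ^ r := by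
        push_cast; ring
    _ ≤ ((4 ^ r : ℕ) : ℝ≥0∞) * (1 / 4) ^ r := by gcongr
    _ = 1 := by
        push_cast
        rw [← mul_pow, one_div, ENNReal.mul_inv_cancel (by norm_num) (by norm_num), one_pow]

/-- The constant in the bound on the logarithm of the number of experts. -/
noncomputable def sizeConst : ℝ :=
  20 + (10 * Real.log 10 + 1) / Real.log (Real.log 3)

theorem sizeConst_pos : 0 < sizeConst := by
  have h1 := loglog_three_pos
  have h2 : 0 < Real.log 10 := Real.log_pos (by norm_num)
  unfold sizeConst
  positivity

/-- The main term is `r * log (r * N)`. Terms of order `log T` alone are absorbed because `log (log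
T)` is at least `log (log 3) > 0`; this is where `3 ≤ T` and the quotient in `sizeConst` come from.
-/
theorem log_experts_le {T r N : ℕ} {d : ℝ} (hT : 3 ≤ T) (hd : 0 ≤ d) (hr0 : 0 < r)
    (hr : (r : ℝ) ≤ 10 * Real.log T) (hN0 : 0 < N)
    (hN : (N : ℝ) ≤ Real.exp (d + Real.log (Real.log T))) :
    Real.log (((r * N) ^ r : ℕ) : ℝ) + Real.log T
      ≤ sizeConst * (Real.log T * (d + Real.log (Real.log T))) := by
  have hT1 := one_lt_log hT
  have hc := loglog_three_pos
  have hcl := loglog_three_le hT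
  have h10 : 0 < Real.log 10 := Real.log_pos (by norm_num)
  have hr0' : (0 : ℝ) < r := by exact_mod_cast hr0
  have hN0' : (0 : ℝ) < N := by exact_mod_cast hN0
  have h1 : Real.log r ≤ Real.log 10 + Real.log (Real.log T) := by
    rw [← Real.log_mul (by norm_num) (by linarith)]
    exact Real.log_le_log hr0' hr
  have h2 : Real.log N ≤ d + Real.log (Real.log T) := (Real.log_le_iff_le_exp hN0').2 hN
  set a := Real.log T
  set b := Real.log (Real.log T)
  set c := Real.log (Real.log 3)
  have h3 : 1 ≤ (d + b) / c := by rw [le_div_iff₀ hc]; linarith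
  have h4 : Real.log (((r * N) ^ r : ℕ) : ℝ) = r * (Real.log r + Real.log N) := by
    push_cast
    rw [Real.log_pow, Real.log_mul hr0'.ne' hN0'.ne']
  have h5 : Real.log r + Real.log N ≤ Real.log 10 + 2 * (d + b) := by linarith
  have h6 : (r : ℝ) * (Real.log r + Real.log N) ≤ 10 * a * (Real.log 10 + 2 * (d + b)) :=
    mul_le_mul hr h5 (add_nonneg (Real.log_natCast_nonneg _) (Real.log_natCast_nonneg _))
      (by linarith)
  have h7 : sizeConst * (a * (d + b))
      = 20 * a * (d + b) + a * (10 * Real.log 10 + 1) * ((d + b) / c) := by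
    unfold sizeConst; ring
  have h8 : a * (10 * Real.log 10 + 1) * 1 ≤ a * (10 * Real.log 10 + 1) * ((d + b) / c) := by
    gcongr
  rw [h4, h7]
  linarith

theorem exists_privateLearner {H : Set (X → Bool)} (hH : repDim H < ⊤) {T : ℕ} (hT : 3 ≤ T)
    {ε : ℝ} (hε : 0 < ε) :
    ∃ A : OnlineLearner X T, IsPureDP ε A.law ∧ ∀ S : Fin T → X × Bool, Realizable H S →
      A.expectedMistakes S ≤ ENNReal.ofReal (314 * sizeConst ^ 2 * (Real.log T ^ 2 *
        ((repDim H).toReal + Real.log (Real.log T)) ^ 2 / min ε 1)) := by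
  have hT1 := one_lt_log hT
  have hll := loglog_three_pos.trans_le (loglog_three_le hT)
  have hd : 0 ≤ (repDim H).toReal := ENNReal.toReal_nonneg
  -- The positive slack `log (log T)` gives a representation of size below `s` without assuming that
  -- the infimum is attained.
  set s := (repDim H).toReal + Real.log (Real.log T) with hs
  have hlt : repDim H < ENNReal.ofReal s := by
    rw [← ENNReal.ofReal_toReal hH.ne]
    exact (ENNReal.ofReal_lt_ofReal_iff (by linarith)).2 (by linarith)
  simp only [repDim, iInf_lt_iff] at hlt
  obtain ⟨P, hP, hsize⟩ := hlt
  obtain ⟨μ, hμ, hweak⟩ := exists_weak_list hP hsize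
  have hN0 : 0 < ⌊Real.exp s⌋₊ := Nat.floor_pos.2 (Real.one_le_exp (by linarith))
  have hN : (⌊Real.exp s⌋₊ : ℝ) ≤ Real.exp s := Nat.floor_le (Real.exp_pos s).le
  generalize ⌊Real.exp s⌋₊ = N at *
  obtain ⟨r, hr⟩ : ∃ r, r = ⌈8 * Real.log T⌉₊ + 1 := ⟨_, rfl⟩
  obtain ⟨hr1, hr2⟩ := boosting_rounds hT hr
  have hr0 : 0 < r := by lia
  -- The same `r` serves as the number of copies per stage and the number of stages: the failure
  -- probability `r * (1 / 4) ^ r` is at most `1 / T`.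
  obtain ⟨ν, hν, hamp⟩ := exists_amplified_list μ r
  have hπ : IsProbabilityMeasure ((Measure.pi fun _ : Fin r => ν).map majorityVotes) :=
    Measure.isProbabilityMeasure_map (measurable_majorityVotes _ r).aemeasurable
  have : Nonempty (Fin r → Fin r × Fin N) := ⟨fun _ => (⟨0, hr0⟩, ⟨0, hN0⟩)⟩
  obtain ⟨A, hA, hmist⟩ := exists_learner_of_experts
    ((Measure.pi fun _ : Fin r => ν).map majorityVotes) hT1.le hε
  refine ⟨A, hA, fun S hS => (hmist S ?_).trans (ENNReal.ofReal_le_ofReal ?_)⟩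
  · refine le_trans ?_ (horizon_mul_failure_le hr1)
    gcongr
    refine measure_majorityVotes_le ν hr1 fun u hu => ?_
    rw [hamp]
    gcongr
    exact hweak T S hS (by lia) u hu
  · have h1 : Fintype.card (Fin r → Fin r × Fin N) = (r * N) ^ r := by simp
    have h2 := log_experts_le hT hd hr0 hr2 hN0 hN
    have h3 : 0 ≤ Real.log (((r * N) ^ r : ℕ) : ℝ) := Real.log_natCast_nonneg _
    have he : 0 < min ε 1 := lt_min hε one_pos
    rw [h1]
    calc _ ≤ 314 * (sizeConst * (Real.log T * s)) ^ 2 / min ε 1 := by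
          gcongr
      _ = _ := by ring

/-- The learner that always predicts `false`. -/
noncomputable def constLearner (X : Type u) (T : ℕ) : OnlineLearner X T where
  Ω := PUnit
  μ := Measure.dirac PUnit.unit
  predict _ _ _ _ := false
  measurable_predict _ _ := measurable_const

theorem isPureDP_constLearner (T : ℕ) {ε : ℝ} (hε : 0 < ε) :
    IsPureDP ε (constLearner X T).law := by
  intro S₁ S₂ _ O _
  have : (constLearner X T).law S₁ = (constLearner X T).law S₂ := rfl
  rw [this]
  refine le_mul_of_one_le_left zero_le ?_
  rw [ENNReal.one_le_ofReal]
  exact Real.one_le_exp hε.le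

theorem OnlineLearner.expectedMistakes_le {T : ℕ} (A : OnlineLearner X T) (S : Fin T → X × Bool) :
    A.expectedMistakes S ≤ T := by
  calc A.expectedMistakes S ≤ ∫⁻ _, (T : ℝ≥0∞) ∂A.μ := by
        refine lintegral_mono fun ω => ?_
        refine (Finset.sum_le_card_nsmul _ _ 1 fun t _ => ?_).trans (by simp)
        split_ifs <;> simp
    _ = T := by simp

theorem isLittleO_mistakeBound (c d : ℝ) (hd : 0 ≤ d) :
    (fun T : ℕ => if T < 3 then (2 : ℝ)
        else c * (Real.log T ^ 2 * (d + Real.log (Real.log T)) ^ 2))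
      =o[Filter.atTop] fun T : ℕ => (T : ℝ) := by
  have hlog : (fun T : ℕ => Real.log T ^ 4) =o[Filter.atTop] fun T : ℕ => (T : ℝ) :=
    (Real.isLittleO_pow_log_id_atTop (n := 4)).comp_tendsto tendsto_natCast_atTop_atTop
  refine Asymptotics.IsBigO.trans_isLittleO ?_ hlog
  refine Asymptotics.IsBigO.of_bound (|c| * (d + 1) ^ 2) ?_
  filter_upwards [Filter.eventually_ge_atTop 3] with T hT
  have h1 := one_lt_log hT
  have h2 := loglog_three_pos.trans_le (loglog_three_le hT)
  have h3 : Real.log (Real.log T) ≤ Real.log T := Real.log_le_self (by linarith)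
  rw [if_neg (by lia), Real.norm_eq_abs, Real.norm_eq_abs, abs_mul,
    abs_of_nonneg (a := Real.log T ^ 2 * _) (by positivity),
    abs_of_nonneg (a := Real.log T ^ 4) (by positivity)]
  have h4 : d + Real.log (Real.log T) ≤ (d + 1) * Real.log T := by nlinarith
  calc |c| * (Real.log T ^ 2 * (d + Real.log (Real.log T)) ^ 2)
      ≤ |c| * (Real.log T ^ 2 * ((d + 1) * Real.log T) ^ 2) := by gcongr
    _ = _ := by ring

theorem onlineLearnableDP_of_repDim_lt_top {H : Set (X → Bool)} (hH : repDim H < ⊤) {ε : ℝ}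
    (hε : 0 < ε) : OnlineLearnableDP ε H := by
  have h : ∀ T : ℕ, ∃ A : OnlineLearner X T, IsPureDP ε A.law ∧
      ∀ S : Fin T → X × Bool, Realizable H S → A.expectedMistakes S ≤ ENNReal.ofReal
        (if T < 3 then (2 : ℝ) else 314 * sizeConst ^ 2 / min ε 1 *
          (Real.log T ^ 2 * ((repDim H).toReal + Real.log (Real.log T)) ^ 2)) := by
    intro T
    by_cases hT : T < 3
    · refine ⟨constLearner X T, isPureDP_constLearner T hε, fun S _ => ?_⟩
      rw [if_pos hT]
      refine (OnlineLearner.expectedMistakes_le _ S).trans ?_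
      rw [ENNReal.ofReal_ofNat]
      exact_mod_cast Nat.le_of_lt_succ hT
    · obtain ⟨A, hA, hm⟩ := exists_privateLearner hH (not_lt.1 hT) hε
      refine ⟨A, hA, fun S hS => (hm S hS).trans (le_of_eq ?_)⟩
      rw [if_neg hT]
      congr 1
      ring
  choose A hA hm using h
  exact ⟨A, _, isLittleO_mistakeBound _ _ ENNReal.toReal_nonneg, fun T => ⟨hA T, hm T⟩⟩

end Final
end PrivateOnline

theorem mainTheorem5 :
    (∃ C : ℝ, 0 < C ∧
      ∀ (X : Type u) (H : Set (X → Bool)), PrivateOnline.repDim H < ⊤ →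
        ∀ T : ℕ, 3 ≤ T → ∀ ε : ℝ, 0 < ε →
          ∃ A : PrivateOnline.OnlineLearner X T,
            PrivateOnline.IsPureDP ε A.law ∧
              ∀ S : Fin T → X × Bool, PrivateOnline.Realizable H S →
                A.expectedMistakes S ≤
                  ENNReal.ofReal (C * (Real.log T ^ 2 *
                    ((PrivateOnline.repDim H).toReal + Real.log (Real.log T)) ^ 2 / min ε 1))) ∧
    (∀ (X : Type u) (H : Set (X → Bool)),
      (∃ ε : ℝ, 0 < ε ∧ PrivateOnline.PACLearnableDP ε H) →
        ∀ ε : ℝ, 0 < ε → PrivateOnline.OnlineLearnableDP ε H) := by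
  refine ⟨⟨314 * PrivateOnline.sizeConst ^ 2, ?_, fun X H hH T hT ε hε =>
    PrivateOnline.exists_privateLearner hH hT hε⟩, ?_⟩
  · have := PrivateOnline.sizeConst_pos
    positivity
  · rintro X H ⟨ε₀, -, hpac⟩ ε hε
    exact PrivateOnline.onlineLearnableDP_of_repDim_lt_top (PrivateOnline.repDim_lt_top hpac) hε
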